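/- Let $n\ge 2$, write $e(z)=e^{iz}$, and let $\hat f(\xi)=\int f(x)\,e(-2\pi x\cdot\xi)\,dx$ (extended to $L^2(\mathbb R^n)$). Let $\varphi\in\mathcal S(\mathbb R)$ be a non-negative function with $\varphi(0)=1$ and $\operatorname{supp}\hat\varphi\subset(-1,1)$. **Solutions.** For $f\in L^2(\mathbb R^n)$, $t>0$, $x\in\mathbb R^n$ put $$e^{it\hbar\Delta/2}f(x)=\lim_{N\to\infty}\int_{[-N/2,N/2]^n}\hat f(\xi)\,e(-\pi t|\xi|^2+2\pi x\cdot\xi)\,d\xi \qquad(\hbar=\tfrac1{2\pi}),$$ at every $(x,t)$ at which this pointwise limit exists; $\limsup_{t\to0^+}$ below is over those $t>0$ for which the limit exists at $x$. **Parameters.** Let $0<a\le1$, $0<b\le\frac12$, $2a\ge1+b$, and for $k\in\mathbb N$ let $$R_k=2^k,\qquad D_k=R_k^{\frac{n-(n-1)a+nb}{n+1}},\qquad Q_k=R_k^{\frac{n-1}{n+1}(2a-b-1)},\qquad s=\frac14+\frac{n-1}{2(n+1)}\bigl(n-(n-1)a-b\bigr).$$ **Initial datum.** Let $$f_{D_k}(x)=e(2\pi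 R_kx_1)\,\varphi(R_k^{1/2}x_1)\prod_{j=2}^n\Bigl(\varphi(x_j)\sum_{l\in\mathbb Z,\ \frac{R_k}{2D_k}<l<\frac{R_k}{D_k}}e(2\pi D_k l x_j)\Bigr),\qquad g_{a,b}=\sum_{k\ge k_0}R_k^{-s}\,\frac{k}{\|f_{D_k}\|_2}\,f_{D_k}.$$ **Divergence set.** For integers $q\ge 1$ and $p_1,\dots,p_n$, the point $(p_1/q,\dots,p_n/q)$ is an *admissible fraction* if $\gcd(p_1,q)=1$, $p_2,\dots,p_n$ are all even when $q\equiv0\pmod 4$, and $p_2,\dots,p_n$ are all odd when $q\equiv2\pmod 4$. For $c>0$ let $F_k$ be the union of the closed slabs with side lengths $cR_k^{-1/2}\times cR_k^{-1}\times\cdots\times cR_k^{-1}$ centred at $$\Bigl(\frac{2p_1R_k}{qD_k^2},\frac{p_2}{D_kq},\dots,\frac{p_n}{D_kq}\Bigr),$$ over all admissible fractions with $1\le q\le Q_k$, and let $F=\limsup_{k\to\infty}F_k=\bigcap_{N}\bigcup_{k\ge N}F_k$. **Theorem.** There is $\varepsilon>0$, depending only on $n$ and $\varphi$, such that for all $a,b$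 as above there is $K$ such that for every $k_0\ge K$: all $f_{D_k}$ with $k\ge k_0$ are non-zero, the series defining $g_{a,b}$ converges in $L^2(\mathbb R^n)$, and $g_{a,b}\in H^{s'}(\mathbb R^n)$ for every $s'<s$. Moreover, for all $0<c\le\varepsilon$ and $0<c_1\le\varepsilon c$, with $c_0=\frac1{10}c_1$, there is a set $\Omega\subset\mathbb R^n$ with $\mathcal H^\gamma(\Omega)=0$ for every $\gamma>n-2s$, such that $$\limsup_{t\to0^+}\bigl|e^{it\hbar\Delta/2}g_{a,b}(x)\bigr|=\infty\qquad\text{for every }x\in\bigl(F\cap([c_0,c_1]\times[0,c_1]^{n-1})\bigr)\setminus\Omega .$$ -/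

import Mathlib

open MeasureTheory Filter Topology
open scoped FourierTransform SchwartzMap ENNReal

noncomputable section

namespace CarlesonFractal

/-- `e(z) = exp (i z)`. -/
def e (z : ℝ) : ℂ := Complex.exp (Complex.I * (z : ℂ))

/-- The space `L²(ℝⁿ)` of complex-valued functions, for Lebesgue measure. -/
abbrev L2 (n : ℕ) : Type := Lp (α := EuclideanSpace ℝ (Fin n)) ℂ 2 volume

/-! ### The linear Schrödinger flow -/

/-- The cube of side `N` centred at the origin. -/
def cube (n : ℕ) (N : ℝ) : Set (EuclideanSpace ℝ (Fin n)) :=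
  {ξ | ∀ j, |ξ j| ≤ N / 2}

/-- The truncated solution
`S_N(t) f(x) = ∫_{Q(N)} f̂(ξ) e(-π t |ξ|² + 2π x·ξ) dξ`, where `f̂` is the `L²` Fourier transform
with the normalisation `f̂(ξ) = ∫ f(x) e(-2π x·ξ) dx`. -/
def truncatedFlow {n : ℕ} (f : L2 n) (N t : ℝ)
    (x : EuclideanSpace ℝ (Fin n)) : ℂ :=
  ∫ ξ in cube n N,
    (𝓕 f : L2 n) ξ *
      e (-Real.pi * t * ‖ξ‖ ^ 2 + 2 * Real.pi * inner ℝ x ξ)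

/-- The pointwise limit `lim_{N → ∞} S_N(t) f(x)` exists. -/
def FlowDefinedAt {n : ℕ} (f : L2 n) (t : ℝ)
    (x : EuclideanSpace ℝ (Fin n)) : Prop :=
  ∃ u : ℂ, Tendsto (fun N : ℝ => truncatedFlow f N t x) atTop (𝓝 u)

/-- The solution `e^{i t ħ Δ / 2} f (x) = lim_{N → ∞} S_N(t) f(x)` (with `ħ = 1 / (2π)`);
meaningful where `FlowDefinedAt f t x` holds. -/
def flow {n : ℕ} (f : L2 n) (t : ℝ)
    (x : EuclideanSpace ℝ (Fin n)) : ℂ :=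
  limUnder atTop (fun N : ℝ => truncatedFlow f N t x)

/-- `limsup_{t → 0⁺} |e^{i t ħ Δ / 2} f (x)|`, taken over those `t > 0` at which the
solution at `x` exists as a pointwise limit. If there are no such `t` close to `0`, this is `0`. -/
def flowLimsup {n : ℕ} (f : L2 n)
    (x : EuclideanSpace ℝ (Fin n)) : ℝ≥0∞ :=
  limsup (fun t : ℝ => ‖flow f t x‖ₑ) (𝓝[{t : ℝ | 0 < t ∧ FlowDefinedAt f t x}] 0)

/-! ### The building blocks of the initial datum -/

/-- The factor in the first variable, `e(2π R y) φ(R^{1/2} y)`. -/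
def firstFactor (φ : 𝓢(ℝ, ℝ)) (R y : ℝ) : ℂ :=
  e (2 * Real.pi * R * y) * (φ (Real.sqrt R * y) : ℂ)

/-- The integers `l` with `R / (2D) < l < R / D`. -/
def freqs (R D : ℝ) : Finset ℤ := Finset.Ioo ⌊R / (2 * D)⌋ ⌈R / D⌉

lemma mem_freqs (R D : ℝ) (l : ℤ) : l ∈ freqs R D ↔ R / (2 * D) < l ∧ (l : ℝ) < R / D := by
  simp [freqs, Int.floor_lt, Int.lt_ceil]

/-- The factor in each other variable,
`φ(y) ∑_{R / (2D) < l < R / D} e(2π D l y)`. -/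
def otherFactor (φ : 𝓢(ℝ, ℝ)) (R D y : ℝ) : ℂ :=
  (φ y : ℂ) * ∑ l ∈ freqs R D, e (2 * Real.pi * D * l * y)

/-- The function `f_D` (with parameters `R` and `D`) on `ℝⁿ`; the coordinate `x 0` is the first
one. -/
def fD {n : ℕ} [NeZero n] (φ : 𝓢(ℝ, ℝ)) (R D : ℝ) (x : EuclideanSpace ℝ (Fin n)) : ℂ :=
  firstFactor φ R (x 0) * ∏ j ∈ Finset.univ.erase (0 : Fin n), otherFactor φ R D (x j)

lemma continuous_e : Continuous e := by
  unfold e; fun_prop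

lemma norm_e (z : ℝ) : ‖e z‖ = 1 := by
  unfold e; rw [mul_comm]; exact Complex.norm_exp_ofReal_mul_I z

lemma continuous_firstFactor (φ : 𝓢(ℝ, ℝ)) (R : ℝ) : Continuous (firstFactor φ R) := by
  have h1 := φ.continuous
  have h2 := continuous_e
  unfold firstFactor; fun_prop

lemma continuous_otherFactor (φ : 𝓢(ℝ, ℝ)) (R D : ℝ) : Continuous (otherFactor φ R D) := by
  have h1 := φ.continuous
  have h2 := continuous_e
  unfold otherFactor; fun_prop

lemma integrable_firstFactor (φ : 𝓢(ℝ, ℝ)) {R : ℝ} (hR : 0 < R) :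
    Integrable (fun y => ‖firstFactor φ R y‖ ^ 2) := by
  have h : Integrable (fun y => ‖φ y‖ ^ 2) :=
    (memLp_two_iff_integrable_sq_norm φ.continuous.aestronglyMeasurable).1 (φ.memLp 2)
  have h2 := h.comp_mul_left' (Real.sqrt_pos.2 hR).ne'
  refine h2.congr (Eventually.of_forall fun y => ?_)
  simp [firstFactor, norm_e]

lemma integrable_otherFactor (φ : 𝓢(ℝ, ℝ)) (R D : ℝ) :
    Integrable (fun y => ‖otherFactor φ R D y‖ ^ 2) := by
  have h : Integrable (fun y => ‖φ y‖ ^ 2) :=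
    (memLp_two_iff_integrable_sq_norm φ.continuous.aestronglyMeasurable).1 (φ.memLp 2)
  refine (h.const_mul (((freqs R D).card : ℝ) ^ 2)).mono'
    ((continuous_otherFactor φ R D).norm.pow 2).aestronglyMeasurable
    (Eventually.of_forall fun y => ?_)
  have hs : ‖∑ l ∈ freqs R D, e (2 * Real.pi * D * l * y)‖ ≤ (freqs R D).card := by
    refine (norm_sum_le _ _).trans ?_
    simp [norm_e]
  have h3 : ‖otherFactor φ R D y‖ ≤ (freqs R D).card * ‖φ y‖ := by
    unfold otherFactor
    rw [norm_mul, Complex.norm_real, mul_comm]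
    gcongr
  rw [Real.norm_of_nonneg (by positivity), ← mul_pow]
  gcongr

lemma memLp_fD {n : ℕ} [NeZero n] (φ : 𝓢(ℝ, ℝ)) {R : ℝ} (hR : 0 < R) (D : ℝ) :
    MemLp (fD (n := n) φ R D) 2 := by
  have hc : Continuous (fD (n := n) φ R D) := by
    have h1 := continuous_firstFactor φ R
    have h2 := continuous_otherFactor φ R D
    unfold fD; fun_prop
  rw [memLp_two_iff_integrable_sq_norm hc.aestronglyMeasurable]
  let F : Fin n → ℝ → ℝ := fun j y =>
    if j = 0 then ‖firstFactor φ R y‖ ^ 2 else ‖otherFactor φ R D y‖ ^ 2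
  have hF : ∀ j, Integrable (F j) (volume : Measure ℝ) := fun j => by
    by_cases hj : j = 0
    · simpa [F, hj] using integrable_firstFactor φ hR
    · simpa [F, hj] using integrable_otherFactor φ R D
  have h : Integrable (fun x : Fin n → ℝ => ∏ j, F j (x j)) volume :=
    Integrable.fintype_prod hF
  rw [← (PiLp.volume_preserving_toLp (Fin n)).integrable_comp_emb
    (MeasurableEquiv.toLp 2 (Fin n → ℝ)).measurableEmbedding]
  refine h.congr (Eventually.of_forall fun x => ?_)
  simp only [Function.comp, fD, norm_mul, mul_pow, norm_prod]
  rw [← Finset.mul_prod_erase _ _ (Finset.mem_univ (0 : Fin n)), ← Finset.prod_pow]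
  congr 1
  exact Finset.prod_congr rfl fun j hj => by simp [F, Finset.ne_of_mem_erase hj]

/-! ### The parameters -/

/-- The admissible range of the parameters `a`, `b`. -/
def AdmissibleParams (a b : ℝ) : Prop :=
  0 < a ∧ a ≤ 1 ∧ 0 < b ∧ b ≤ 1 / 2 ∧ 1 + b ≤ 2 * a

/-- `R_k = 2^k`. -/
def R (k : ℕ) : ℝ := 2 ^ k

lemma R_pos (k : ℕ) : 0 < R k := by unfold R; positivity

/-- `D_k = R_k ^ ((n - (n-1) a + n b) / (n+1))`. -/
def D (n : ℕ) (a b : ℝ) (k : ℕ) : ℝ :=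
  R k ^ (((n : ℝ) - ((n : ℝ) - 1) * a + (n : ℝ) * b) / ((n : ℝ) + 1))

/-- `Q_k = R_k ^ ((n-1) / (n+1) * (2 a - b - 1))`. -/
def Q (n : ℕ) (a b : ℝ) (k : ℕ) : ℝ :=
  R k ^ (((n : ℝ) - 1) / ((n : ℝ) + 1) * (2 * a - b - 1))

/-- The exponent `s = 1/4 + (n-1) / (2 (n+1)) * (n - (n-1) a - b)`. -/
def sExp (n : ℕ) (a b : ℝ) : ℝ :=
  1 / 4 + ((n : ℝ) - 1) / (2 * ((n : ℝ) + 1)) * ((n : ℝ) - ((n : ℝ) - 1) * a - b)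

/-! ### The initial datum -/

/-- The function `f_{D_k}` as an element of `L²(ℝⁿ)`. -/
def fDk (n : ℕ) [NeZero n] (φ : 𝓢(ℝ, ℝ)) (a b : ℝ) (k : ℕ) : L2 n :=
  (memLp_fD (n := n) φ (R_pos k) (D n a b k)).toLp

/-- The `k`-th term `R_k^{-s} (k / ‖f_{D_k}‖₂) f_{D_k}`. -/
def gTerm (n : ℕ) [NeZero n] (φ : 𝓢(ℝ, ℝ)) (a b : ℝ) (k : ℕ) : L2 n :=
  ((R k ^ (-sExp n a b) * ((k : ℝ) / ‖fDk n φ a b k‖) : ℝ) : ℂ) • fDk n φ a b k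

/-- The initial datum `g_{a,b} = ∑_{k ≥ k₀} R_k^{-s} (k / ‖f_{D_k}‖₂) f_{D_k}`, the series
being summed in `L²(ℝⁿ)`. -/
def g (n : ℕ) [NeZero n] (φ : 𝓢(ℝ, ℝ)) (a b : ℝ) (k₀ : ℕ) : L2 n :=
  ∑' m : ℕ, gTerm n φ a b (k₀ + m)

/-! ### The sets of divergence -/

/-- `(p 0 / q, …, p (n-1) / q)` is an admissible fraction. -/
def AdmissibleFraction {n : ℕ} [NeZero n] (p : Fin n → ℤ) (q : ℤ) : Prop :=
  IsCoprime (p 0) q ∧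
    (q ≡ 0 [ZMOD 4] → ∀ j, j ≠ 0 → Even (p j)) ∧
    (q ≡ 2 [ZMOD 4] → ∀ j, j ≠ 0 → Odd (p j))

/-- The closed slab of dimensions `c R^{-1/2} × c R^{-1} × ⋯ × c R^{-1}`, with `R = R_k`, centred at
`(2 p₁ R / (q D²), p₂ / (D q), …, pₙ / (D q))`, with `D = D_k`. -/
def slab {n : ℕ} [NeZero n] (c a b : ℝ) (k : ℕ) (p : Fin n → ℤ) (q : ℤ) :
    Set (EuclideanSpace ℝ (Fin n)) :=
  {x | |x 0 - 2 * p 0 * R k / (q * D n a b k ^ 2)| ≤ c * R k ^ (-(1 / 2) : ℝ) / 2 ∧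
    ∀ j, j ≠ 0 → |x j - p j / (D n a b k * q)| ≤ c * (R k)⁻¹ / 2}

/-- `F_k`, the union of the slabs of scale `k` over the admissible fractions with
denominator `1 ≤ q ≤ Q_k`. -/
def divSetAt (n : ℕ) [NeZero n] (c a b : ℝ) (k : ℕ) : Set (EuclideanSpace ℝ (Fin n)) :=
  {x | ∃ (p : Fin n → ℤ) (q : ℤ), 1 ≤ q ∧ (q : ℝ) ≤ Q n a b k ∧ AdmissibleFraction p q ∧
    x ∈ slab c a b k p q}

/-- The `(a,b)`-set of divergence `F = limsup_k F_k = ⋂_N ⋃_{k ≥ N} F_k`. -/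
def divSet (n : ℕ) [NeZero n] (c a b : ℝ) : Set (EuclideanSpace ℝ (Fin n)) :=
  ⋂ N : ℕ, ⋃ k ≥ N, divSetAt n c a b k

/-- The box `[c₀, c₁] × [0, c₁]^{n-1}`. -/
def box (n : ℕ) [NeZero n] (c₀ c₁ : ℝ) : Set (EuclideanSpace ℝ (Fin n)) :=
  {x | x 0 ∈ Set.Icc c₀ c₁ ∧ ∀ j, j ≠ 0 → x j ∈ Set.Icc 0 c₁}

end CarlesonFractal

end

/-!
The divergence of the solution comes from one term at a time. On a slab of scale `k` with centre
given by the fractions `p_j / q`, the time `t = 2 p₁ / (q D_k²)` satisfies `t R_k ≈ x₁`, so the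
travelling packet in the first variable is at its peak, while in each of the other variables the
evolved datum is a quadratic Gauss sum `∑ e(2π (-p₁ l² + p_j l) / q)` over the `M ≈ R_k / (2 D_k)`
frequencies, with slowly varying weights. The parity conditions in the definition of an admissible
fraction exclude cancellation in the complete sum (`sqrt_le_norm_quadGaussSum`), incomplete sums are
controlled by completion (`norm_sum_range_sub_quadGaussSum_le`), and summation by parts removes the
weights, so each such variable contributes `M / √q` (`div_sqrt_le_norm_weighted_gauss`). With the
normalisation `R_k^{-s} k / ‖f_{D_k}‖₂` and `q ≤ Q_k`, the `k`-th term has size at least a constant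
times `k` (`exists_mul_le_coeff_mul`, `le_norm_coeff_mul_evolved`).

At the same time `t` the pieces of any other scale `j` are centred at `t R_j`, which differs from
`x₁` by at least a constant times `1 + t R_j`. Repeated integration by parts
(`exists_pow_mul_norm_packet_le`) makes their contribution decay faster than any power of `R_j`, so
they add up to a bounded quantity (`exists_coeff_mul_norm_evolved_le`). Since a point of the set of
divergence lies in slabs of arbitrarily large scale, the solution is unbounded along a sequence of
times tending to `0`.

The pointwise limit defining the solution exists at every `x` and every `t > 0`, so the exceptional
set `Ω` can be taken empty. At a fixed `t > 0` the pieces of high frequency have left every bounded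
region, in each variable, at speed comparable to `R_k`. A sharp cut-off in frequency leaves only one
integration by parts in each variable, but this already bounds the `k`-th term by a constant times
`k R_k^{-1/2}`, uniformly in the cut-off (`exists_norm_truncatedFlow_fDk_le`), and dominated
convergence applies to the series (`hasSum_flow_g`).

On the Fourier side `f_{D_k}` is a smooth function with compact support, a tensor product of
translates and dilates of `φ̂`; this gives the norm of `f_{D_k}`, the factorisation of the truncated
solution over the coordinates, and the Sobolev regularity of the sum.
-/

noncomputable section

namespace CarlesonFractal

/-! ### Quadratic oscillatory integrals in one variable -/

/-- The wave packet `∫_α^β ψ(η) e(-π τ η² + 2π y η) dη` cut off in frequency to `[α, β]`. -/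
def cutPacket (ψ : 𝓢(ℝ, ℂ)) (α β τ y : ℝ) : ℂ :=
  ∫ η in α..β, ψ η * e (-Real.pi * τ * η ^ 2 + 2 * Real.pi * y * η)

/-- The wave packet `∫ ψ(η) e(-π τ η² + 2π y η) dη`. -/
def packet (ψ : 𝓢(ℝ, ℂ)) (τ y : ℝ) : ℂ :=
  ∫ η, ψ η * e (-Real.pi * τ * η ^ 2 + 2 * Real.pi * y * η)

lemma e_add (x y : ℝ) : e (x + y) = e x * e y := by
  unfold e; rw [← Complex.exp_add]; push_cast; ring_nf

lemma e_zero : e 0 = 1 := by simp [e]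

lemma e_sum {ι : Type*} (s : Finset ι) (f : ι → ℝ) : e (∑ i ∈ s, f i) = ∏ i ∈ s, e (f i) := by
  classical
  induction s using Finset.induction_on with
  | empty => simp [e_zero]
  | insert i s hi ih => rw [Finset.sum_insert hi, Finset.prod_insert hi, e_add, ih]

lemma norm_e_sub_e_le (x y : ℝ) : ‖e x - e y‖ ≤ |x - y| := by
  have h1 : e x - e y = e y * (e (x - y) - 1) := by
    rw [mul_sub, ← e_add]; simp
  rw [h1, norm_mul, norm_e, one_mul]
  simpa [e] using Real.norm_exp_I_mul_ofReal_sub_one_le (x := x - y)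

lemma hasDerivAt_e_comp {f : ℝ → ℝ} {f' x : ℝ} (hf : HasDerivAt f f' x) :
    HasDerivAt (fun z => e (f z)) (e (f x) * (Complex.I * f')) x := by
  unfold e
  exact ((hf.ofReal_comp).const_mul Complex.I).cexp

lemma continuous_packet_integrand (ψ : 𝓢(ℝ, ℂ)) (τ y : ℝ) :
    Continuous fun η : ℝ => ψ η * e (-Real.pi * τ * η ^ 2 + 2 * Real.pi * y * η) := by
  have h1 := ψ.continuous
  have h2 := continuous_e
  fun_prop

lemma integrable_packet_integrand (ψ : 𝓢(ℝ, ℂ)) (τ y : ℝ) :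
    Integrable fun η : ℝ => ψ η * e (-Real.pi * τ * η ^ 2 + 2 * Real.pi * y * η) := by
  refine (ψ.integrable (μ := volume)).norm.mono'
    (continuous_packet_integrand ψ τ y).aestronglyMeasurable (Eventually.of_forall fun η => ?_)
  simp [norm_e]

lemma norm_packet_le (ψ : 𝓢(ℝ, ℂ)) (τ y : ℝ) : ‖packet ψ τ y‖ ≤ ∫ η, ‖ψ η‖ := by
  refine (norm_integral_le_integral_norm _).trans (le_of_eq ?_)
  simp [norm_e]

lemma norm_cutPacket_le (ψ : 𝓢(ℝ, ℂ)) {α β : ℝ} (h : α ≤ β) (τ y : ℝ) :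
    ‖cutPacket ψ α β τ y‖ ≤ ∫ η, ‖ψ η‖ := by
  refine (intervalIntegral.norm_integral_le_integral_norm h).trans ?_
  rw [intervalIntegral.integral_of_le h]
  refine (setIntegral_le_integral (integrable_packet_integrand ψ τ y).norm
    (Eventually.of_forall fun η => norm_nonneg _)).trans (le_of_eq ?_)
  simp [norm_e]

/-- Multiplication of a Schwartz function by the coordinate. -/
def mulCoord (ψ : 𝓢(ℝ, ℂ)) : 𝓢(ℝ, ℂ) := SchwartzMap.smulLeftCLM ℂ (fun x : ℝ => (x : ℂ)) ψ

lemma mulCoord_apply (ψ : 𝓢(ℝ, ℂ)) (x : ℝ) : mulCoord ψ x = x * ψ x := by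
  unfold mulCoord
  rw [SchwartzMap.smulLeftCLM_apply_apply (by fun_prop)]
  simp

lemma hasDerivAt_packet_integrand (ψ : 𝓢(ℝ, ℂ)) (τ y η : ℝ) :
    HasDerivAt (fun η : ℝ => ψ η * e (-Real.pi * τ * η ^ 2 + 2 * Real.pi * y * η))
      (SchwartzMap.derivCLM ℂ ℂ ψ η * e (-Real.pi * τ * η ^ 2 + 2 * Real.pi * y * η) +
        (-(2 * Real.pi * τ * Complex.I)) *
          (mulCoord ψ η * e (-Real.pi * τ * η ^ 2 + 2 * Real.pi * y * η)) +
        2 * Real.pi * y * Complex.I *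
          (ψ η * e (-Real.pi * τ * η ^ 2 + 2 * Real.pi * y * η))) η := by
  have h1 : HasDerivAt (fun η : ℝ => -Real.pi * τ * η ^ 2 + 2 * Real.pi * y * η)
      (-Real.pi * τ * (2 * η) + 2 * Real.pi * y) η := by
    have := ((hasDerivAt_pow 2 η).const_mul (-Real.pi * τ)).add
      ((hasDerivAt_id η).const_mul (2 * Real.pi * y))
    convert! this using 1
    simp
  have h2 := (ψ.differentiableAt (x := η)).hasDerivAt.mul (hasDerivAt_e_comp h1)
  convert! h2 using 1
  rw [mulCoord_apply, SchwartzMap.derivCLM_apply]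
  push_cast
  ring

/-- One integration by parts in a wave packet with a frequency cut-off. -/
lemma exists_abs_mul_norm_cutPacket_le (ψ : 𝓢(ℝ, ℂ)) :
    ∃ C : ℝ, 0 ≤ C ∧ ∀ α β τ y : ℝ, α ≤ β → |y| * ‖cutPacket ψ α β τ y‖ ≤ C * (1 + |τ|) := by
  obtain ⟨S, hS⟩ := ψ.decay 0 0
  have hS' : ∀ x, ‖ψ x‖ ≤ S := fun x => by simpa using hS.2 x
  set A := ∫ η, ‖SchwartzMap.derivCLM ℂ ℂ ψ η‖ with hA
  set B := ∫ η, ‖mulCoord ψ η‖ with hB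
  have hA0 : 0 ≤ A := integral_nonneg fun _ => norm_nonneg _
  have hB0 : 0 ≤ B := integral_nonneg fun _ => norm_nonneg _
  refine ⟨2 * S + A + 2 * Real.pi * B, by have := hS.1; positivity, fun α β τ y hαβ => ?_⟩
  have hint : ∀ χ : 𝓢(ℝ, ℂ), IntervalIntegrable
      (fun η : ℝ => χ η * e (-Real.pi * τ * η ^ 2 + 2 * Real.pi * y * η)) volume α β :=
    fun χ => (continuous_packet_integrand χ τ y).intervalIntegrable _ _
  have key := intervalIntegral.integral_eq_sub_of_hasDerivAt (a := α) (b := β)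
    (fun η _ => hasDerivAt_packet_integrand ψ τ y η)
    (((hint _).add ((hint _).const_mul _)).add ((hint _).const_mul _))
  rw [intervalIntegral.integral_add ((hint _).add ((hint _).const_mul _)) ((hint _).const_mul _),
    intervalIntegral.integral_add (hint _) ((hint _).const_mul _),
    intervalIntegral.integral_const_mul, intervalIntegral.integral_const_mul] at key
  change cutPacket (SchwartzMap.derivCLM ℂ ℂ ψ) α β τ y + -(2 * Real.pi * τ * Complex.I) *
    cutPacket (mulCoord ψ) α β τ y + 2 * Real.pi * y * Complex.I * cutPacket ψ α β τ y = _ at key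
  have key2 := eq_sub_of_add_eq' key
  have hn : ‖2 * Real.pi * y * Complex.I * cutPacket ψ α β τ y‖
      = 2 * Real.pi * (|y| * ‖cutPacket ψ α β τ y‖) := by
    simp [abs_of_pos Real.pi_pos, mul_assoc]
  have h3 : ‖2 * Real.pi * y * Complex.I * cutPacket ψ α β τ y‖ ≤
      (S + S) + (A + 2 * Real.pi * |τ| * B) := by
    rw [key2]
    refine (norm_sub_le _ _).trans (add_le_add ((norm_sub_le _ _).trans ?_)
      ((norm_add_le _ _).trans (add_le_add (norm_cutPacket_le _ hαβ _ _) ?_)))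
    · simpa [norm_e] using add_le_add (hS' β) (hS' α)
    · rw [norm_mul]
      have : ‖-(2 * Real.pi * τ * Complex.I : ℂ)‖ = 2 * Real.pi * |τ| := by
        simp [abs_of_pos Real.pi_pos]
      rw [this]
      gcongr
      exact norm_cutPacket_le _ hαβ _ _
  rw [hn] at h3
  have hpi : 1 ≤ 2 * Real.pi := by linarith [Real.pi_gt_three]
  have h4 : |y| * ‖cutPacket ψ α β τ y‖ ≤ 2 * Real.pi * (|y| * ‖cutPacket ψ α β τ y‖) :=
    le_mul_of_one_le_left (by positivity) hpi
  have := hS.1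
  have : 0 ≤ |τ| * S := by positivity
  have : 0 ≤ |τ| * A := by positivity
  have : 0 ≤ Real.pi * B := by positivity
  linarith

/-- Repeated integration by parts in a full wave packet. -/
lemma exists_pow_mul_norm_packet_le (m : ℕ) : ∀ ψ : 𝓢(ℝ, ℂ),
    ∃ C : ℝ, 0 ≤ C ∧ ∀ τ y : ℝ, |y| ^ m * ‖packet ψ τ y‖ ≤ C * (1 + |τ|) ^ m := by
  induction m with
  | zero =>
    intro ψ
    exact ⟨∫ η, ‖ψ η‖, integral_nonneg fun _ => norm_nonneg _, fun τ y => by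
      simpa using norm_packet_le ψ τ y⟩
  | succ m ih =>
    intro ψ
    obtain ⟨A, hA0, hA⟩ := ih (SchwartzMap.derivCLM ℂ ℂ ψ)
    obtain ⟨B, hB0, hB⟩ := ih (mulCoord ψ)
    refine ⟨A + 2 * Real.pi * B, by positivity, fun τ y => ?_⟩
    have hint : ∀ χ : 𝓢(ℝ, ℂ), Integrable
        (fun η : ℝ => χ η * e (-Real.pi * τ * η ^ 2 + 2 * Real.pi * y * η)) :=
      fun χ => integrable_packet_integrand χ τ y
    have key := integral_eq_zero_of_hasDerivAt_of_integrable
      (fun η => hasDerivAt_packet_integrand ψ τ y η)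
      (((hint _).add ((hint _).const_mul _)).add ((hint _).const_mul _)) (hint ψ)
    have hadd := integral_add ((hint (SchwartzMap.derivCLM ℂ ℂ ψ)).add
      ((hint (mulCoord ψ)).const_mul (-(2 * Real.pi * τ * Complex.I))))
      ((hint ψ).const_mul (2 * Real.pi * y * Complex.I))
    simp only [Pi.add_apply] at hadd
    rw [hadd, integral_add (hint _) ((hint _).const_mul _),
      integral_const_mul, integral_const_mul] at key
    change packet (SchwartzMap.derivCLM ℂ ℂ ψ) τ y + -(2 * Real.pi * τ * Complex.I) *
      packet (mulCoord ψ) τ y + 2 * Real.pi * y * Complex.I * packet ψ τ y = _ at key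
    have key2 := eq_neg_of_add_eq_zero_right key
    have hn : ‖2 * Real.pi * y * Complex.I * packet ψ τ y‖
        = 2 * Real.pi * (|y| * ‖packet ψ τ y‖) := by
      simp [abs_of_pos Real.pi_pos, mul_assoc]
    have h3 : ‖2 * Real.pi * y * Complex.I * packet ψ τ y‖ ≤
        ‖packet (SchwartzMap.derivCLM ℂ ℂ ψ) τ y‖ +
          2 * Real.pi * |τ| * ‖packet (mulCoord ψ) τ y‖ := by
      rw [key2, norm_neg]
      refine (norm_add_le _ _).trans (le_of_eq ?_)
      simp [abs_of_pos Real.pi_pos]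
    rw [hn] at h3
    have hpi : 1 ≤ 2 * Real.pi := by linarith [Real.pi_gt_three]
    have h4 : |y| * ‖packet ψ τ y‖ ≤ 2 * Real.pi * (|y| * ‖packet ψ τ y‖) :=
      le_mul_of_one_le_left (by positivity) hpi
    calc |y| ^ (m + 1) * ‖packet ψ τ y‖ = |y| ^ m * (|y| * ‖packet ψ τ y‖) := by ring
      _ ≤ |y| ^ m * (‖packet (SchwartzMap.derivCLM ℂ ℂ ψ) τ y‖ +
          2 * Real.pi * |τ| * ‖packet (mulCoord ψ) τ y‖) := by gcongr; exact h4.trans h3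
      _ = |y| ^ m * ‖packet (SchwartzMap.derivCLM ℂ ℂ ψ) τ y‖ +
          2 * Real.pi * |τ| * (|y| ^ m * ‖packet (mulCoord ψ) τ y‖) := by ring
      _ ≤ A * (1 + |τ|) ^ m + 2 * Real.pi * |τ| * (B * (1 + |τ|) ^ m) := by
          exact add_le_add (hA τ y) (mul_le_mul_of_nonneg_left (hB τ y) (by positivity))
      _ ≤ (A + 2 * Real.pi * B) * (1 + |τ|) ^ (m + 1) := by
          have h5 : 0 ≤ (1 + |τ|) ^ m := by positivity
          have h6 : 0 ≤ (1 + |τ|) ^ m * (A * |τ|) := by positivity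
          have h7 : 0 ≤ (1 + |τ|) ^ m * (Real.pi * B) := by positivity
          rw [pow_succ]
          nlinarith

/-- A wave packet is Lipschitz in its two parameters. -/
lemma exists_norm_packet_sub_le (ψ : 𝓢(ℝ, ℂ)) :
    ∃ B : ℝ, 0 ≤ B ∧ ∀ τ y τ' y' : ℝ,
      ‖packet ψ τ y - packet ψ τ' y'‖ ≤ B * (|τ - τ'| + |y - y'|) := by
  set A := ∫ η, ‖mulCoord ψ η‖ with hA
  set A' := ∫ η, ‖mulCoord (mulCoord ψ) η‖ with hA'
  have hA0 : 0 ≤ A := integral_nonneg fun _ => norm_nonneg _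
  have hA0' : 0 ≤ A' := integral_nonneg fun _ => norm_nonneg _
  refine ⟨2 * Real.pi * (A + A'), by positivity, fun τ y τ' y' => ?_⟩
  have hi1 : Integrable (fun η => ‖mulCoord ψ η‖) := (SchwartzMap.integrable (μ := volume) _).norm
  have hi2 : Integrable (fun η => ‖mulCoord (mulCoord ψ) η‖) :=
    (SchwartzMap.integrable (μ := volume) _).norm
  unfold packet
  rw [← integral_sub (integrable_packet_integrand ψ _ _) (integrable_packet_integrand ψ _ _)]
  refine (norm_integral_le_of_norm_le
    ((hi2.const_mul (Real.pi * |τ - τ'|)).add (hi1.const_mul (2 * Real.pi * |y - y'|)))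
    (Eventually.of_forall fun η => ?_)).trans ?_
  · rw [← mul_sub, norm_mul]
    refine (mul_le_mul_of_nonneg_left (norm_e_sub_e_le _ _) (norm_nonneg _)).trans ?_
    simp only [Pi.add_apply, mulCoord_apply, norm_mul, Complex.norm_real, Real.norm_eq_abs]
    have h1 : -Real.pi * τ * η ^ 2 + 2 * Real.pi * y * η -
        (-Real.pi * τ' * η ^ 2 + 2 * Real.pi * y' * η) =
        -Real.pi * (τ - τ') * (η * η) + 2 * Real.pi * (y - y') * η := by ring
    rw [h1]
    refine (mul_le_mul_of_nonneg_left (abs_add_le _ _) (norm_nonneg _)).trans (le_of_eq ?_)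
    simp only [abs_mul, abs_neg, abs_of_pos Real.pi_pos, abs_two]
    ring
  · simp only [Pi.add_apply]
    rw [integral_add (hi2.const_mul _) (hi1.const_mul _), integral_const_mul, integral_const_mul]
    have h1 : 0 ≤ Real.pi * A * |τ - τ'| := by positivity
    have h2 : 0 ≤ Real.pi * A' * |τ - τ'| := by positivity
    have h3 : 0 ≤ Real.pi * A' * |y - y'| := by positivity
    linarith

/-- If the window `[α, β]` contains the support of `ψ` then the cut-off has no effect. -/
lemma cutPacket_eq_packet {ψ : 𝓢(ℝ, ℂ)} (hψ : ∀ η, 1 ≤ |η| → ψ η = 0) {α β : ℝ}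
    (hα : α ≤ -1) (hβ : 1 ≤ β) (τ y : ℝ) : cutPacket ψ α β τ y = packet ψ τ y := by
  unfold cutPacket packet
  rw [intervalIntegral.integral_of_le (by linarith)]
  refine setIntegral_eq_integral_of_forall_compl_eq_zero fun η hη => ?_
  have : 1 ≤ |η| := by
    by_contra! h
    rw [abs_lt] at h
    exact hη ⟨by linarith, by linarith⟩
  rw [hψ η this, zero_mul]

/-- A packet of frequency width `1` centred at `v ∈ [R/2, R]` has left every bounded region at a
fixed time `t > 0`, whatever the cut-off. -/
lemma exists_norm_cutPacket_le_div (ψ : 𝓢(ℝ, ℂ)) {t : ℝ} (ht : 0 < t) (x : ℝ) :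
    ∃ C : ℝ, 0 ≤ C ∧ ∀ α β R v : ℝ, α ≤ β → 0 < R → R / 2 ≤ v →
      ‖cutPacket ψ α β t (x - t * v)‖ ≤ C / R := by
  obtain ⟨C, hC0, hC⟩ := exists_abs_mul_norm_cutPacket_le ψ
  set A := ∫ η, ‖ψ η‖ with hA
  have hA0 : 0 ≤ A := integral_nonneg fun _ => norm_nonneg _
  refine ⟨C * (1 + t) * (4 / t) + A * (4 * |x| / t), by positivity, fun α β R v h hR hv => ?_⟩
  rw [le_div_iff₀ hR]
  have hn := norm_nonneg (cutPacket ψ α β t (x - t * v))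
  rcases le_total (4 * |x| / t) R with h1 | h1
  · have h2 : t * R / 4 ≤ |x - t * v| := by
      rw [div_le_iff₀ ht] at h1
      have h3 : t * (R / 2) ≤ t * v := by gcongr
      have h4 : t * v - x ≤ |x - t * v| := by rw [abs_sub_comm]; exact le_abs_self _
      have h5 := le_abs_self x
      linarith
    have h3 := hC α β t (x - t * v) h
    rw [abs_of_pos ht] at h3
    have h4 : t * R / 4 * ‖cutPacket ψ α β t (x - t * v)‖ ≤ C * (1 + t) :=
      (mul_le_mul_of_nonneg_right h2 hn).trans h3
    have h5 : 0 ≤ A * (4 * |x| / t) := by positivity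
    have h6 : ‖cutPacket ψ α β t (x - t * v)‖ * R =
        (t * R / 4 * ‖cutPacket ψ α β t (x - t * v)‖) * (4 / t) := by field_simp
    have h7 := mul_le_mul_of_nonneg_right h4 (show 0 ≤ 4 / t by positivity)
    linarith
  · have h2 : ‖cutPacket ψ α β t (x - t * v)‖ * R ≤ A * (4 * |x| / t) := by
      gcongr
      exact norm_cutPacket_le ψ h _ _
    have : 0 ≤ C * (1 + t) * (4 / t) := by positivity
    linarith

/-- A packet of frequency width `√R` centred at `R` has left every bounded region at a
fixed time `t > 0`, whatever the cut-off. -/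
lemma exists_norm_cutPacket_le_div_sqrt (ψ : 𝓢(ℝ, ℂ)) {t : ℝ} (ht : 0 < t) (x : ℝ) :
    ∃ C : ℝ, 0 ≤ C ∧ ∀ α β R : ℝ, α ≤ β → 1 ≤ R →
      ‖cutPacket ψ α β (t * R) (Real.sqrt R * (x - t * R))‖ ≤ C / Real.sqrt R := by
  obtain ⟨C, hC0, hC⟩ := exists_abs_mul_norm_cutPacket_le ψ
  set A := ∫ η, ‖ψ η‖ with hA
  have hA0 : 0 ≤ A := integral_nonneg fun _ => norm_nonneg _
  refine ⟨C * (1 + t) * (2 / t) + A * (2 * |x| / t), by positivity, fun α β R h hR => ?_⟩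
  have hR0 : 0 < R := by linarith
  have hs : 1 ≤ Real.sqrt R := by simpa using Real.sqrt_le_sqrt hR
  have hs0 : 0 < Real.sqrt R := by linarith
  rw [le_div_iff₀ hs0]
  set P := ‖cutPacket ψ α β (t * R) (Real.sqrt R * (x - t * R))‖ with hP
  have hn : 0 ≤ P := norm_nonneg _
  rcases le_total (2 * |x| / t) R with h1 | h1
  · have h2 : t * R / 2 ≤ |x - t * R| := by
      rw [div_le_iff₀ ht] at h1
      have h4 : t * R - x ≤ |x - t * R| := by rw [abs_sub_comm]; exact le_abs_self _
      have h5 := le_abs_self x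
      linarith
    have h3 := hC α β (t * R) (Real.sqrt R * (x - t * R)) h
    rw [abs_of_pos (by positivity : 0 < t * R), abs_mul, abs_of_pos hs0] at h3
    have h4 : Real.sqrt R * (t * R / 2) * P ≤ C * ((1 + t) * R) := by
      refine (mul_le_mul_of_nonneg_right (mul_le_mul_of_nonneg_left h2 hs0.le) hn).trans
        (h3.trans ?_)
      gcongr
      linarith
    have h5 : 0 ≤ A * (2 * |x| / t) := by positivity
    have h6 : P * Real.sqrt R = (Real.sqrt R * (t * R / 2) * P) * (2 / (t * R)) := by field_simp
    have h7 := mul_le_mul_of_nonneg_right h4 (show 0 ≤ 2 / (t * R) by positivity)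
    have h8 : C * ((1 + t) * R) * (2 / (t * R)) = C * (1 + t) * (2 / t) := by field_simp
    linarith
  · have hsR : Real.sqrt R ≤ R := by
      rw [Real.sqrt_le_left hR0.le]; nlinarith
    have h2 : P * Real.sqrt R ≤ A * (2 * |x| / t) := by
      gcongr
      · exact norm_cutPacket_le ψ h _ _
      · exact hsR.trans h1
    have : 0 ≤ C * (1 + t) * (2 / t) := by positivity
    linarith

/-! ### Complete and incomplete quadratic Gauss sums -/

/-- The complete quadratic Gauss sum `∑_{x mod q} e(2π (a x² + m x) / q)`. -/
def quadGaussSum (q : ℕ) [NeZero q] (a m : ZMod q) : ℂ :=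
  ∑ x : ZMod q, ZMod.stdAddChar (a * x ^ 2 + m * x)

lemma norm_stdAddChar {q : ℕ} [NeZero q] (x : ZMod q) : ‖ZMod.stdAddChar x‖ = 1 := by
  rw [ZMod.stdAddChar_apply]; exact Circle.norm_coe _

/-- The square of a Gauss sum, by the substitution `x = y + h`. -/
lemma quadGaussSum_mul_conj {q : ℕ} [NeZero q] {a : ZMod q} (ha : IsUnit a) (m : ZMod q) :
    quadGaussSum q a m * (starRingEnd ℂ) (quadGaussSum q a m) =
      q * ∑ h : ZMod q with 2 * h = 0, ZMod.stdAddChar (a * h ^ 2 + m * h) := by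
  unfold quadGaussSum
  rw [map_sum, Finset.sum_mul_sum, Finset.sum_comm]
  have h1 : ∀ y : ZMod q, ∑ x : ZMod q, ZMod.stdAddChar (a * x ^ 2 + m * x) *
      (starRingEnd ℂ) (ZMod.stdAddChar (a * y ^ 2 + m * y)) =
      ∑ h : ZMod q, ZMod.stdAddChar (a * h ^ 2 + m * h) * ZMod.stdAddChar (y * (2 * a * h)) := by
    intro y
    rw [← Equiv.sum_comp (Equiv.addRight y)]
    refine Finset.sum_congr rfl fun h _ => ?_
    rw [← AddChar.map_neg_eq_conj, ← AddChar.map_add_eq_mul, ← AddChar.map_add_eq_mul]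
    congr 1
    simp only [Equiv.coe_addRight]
    ring
  rw [Finset.sum_congr rfl fun y _ => h1 y, Finset.sum_comm]
  simp_rw [← Finset.mul_sum, AddChar.sum_mulShift _ (ZMod.isPrimitive_stdAddChar q)]
  rw [Finset.mul_sum, Finset.sum_filter]
  refine Finset.sum_congr rfl fun h _ => ?_
  have h2 : 2 * a * h = 0 ↔ 2 * h = 0 := by
    rw [show 2 * a * h = a * (2 * h) by ring, ha.mul_right_eq_zero]
  simp only [h2, ZMod.card]
  split_ifs <;> simp [mul_comm]

/-- The only frequency shifts surviving in the square of a Gauss sum are `0` and `q / 2`. -/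
lemma eq_zero_or_two_mul_val_eq {q : ℕ} [NeZero q] {h : ZMod q} (hh : 2 * h = 0) :
    h = 0 ∨ 2 * h.val = q := by
  have h1 : ((2 * h.val : ℕ) : ZMod q) = 0 := by simpa using hh
  rw [ZMod.natCast_eq_zero_iff] at h1
  obtain ⟨c, hc⟩ := h1
  have h2 := ZMod.val_lt h
  have h3 : c < 2 := by
    by_contra! h4
    nlinarith
  interval_cases c
  · left
    rw [← ZMod.val_eq_zero]
    omega
  · right; omega

lemma norm_quadGaussSum_le {q : ℕ} [NeZero q] {a : ZMod q} (ha : IsUnit a) (m : ZMod q) :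
    ‖quadGaussSum q a m‖ ≤ Real.sqrt (2 * q) := by
  have h1 : ‖quadGaussSum q a m‖ ^ 2 ≤ 2 * q := by
    have h2 : ‖quadGaussSum q a m‖ ^ 2 =
        ‖quadGaussSum q a m * (starRingEnd ℂ) (quadGaussSum q a m)‖ := by
      rw [norm_mul, RCLike.norm_conj, sq]
    rw [h2, quadGaussSum_mul_conj ha, norm_mul, Complex.norm_natCast, mul_comm]
    gcongr
    refine (norm_sum_le _ _).trans ?_
    simp only [norm_stdAddChar, Finset.sum_const, nsmul_eq_mul, mul_one]
    have h3 : (Finset.univ.filter fun h : ZMod q => 2 * h = 0) ⊆ {0, ((q / 2 : ℕ) : ZMod q)} := by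
      intro h hh
      rw [Finset.mem_filter] at hh
      rcases eq_zero_or_two_mul_val_eq hh.2 with h4 | h4
      · simp [h4]
      · have : q / 2 = h.val := by omega
        simp [this]
    exact_mod_cast (Finset.card_le_card h3).trans Finset.card_le_two
  exact Real.le_sqrt_of_sq_le h1

/-- The parity conditions on an admissible fraction exclude the cancellation in Gauss sums of even
modulus. -/
lemma sqrt_le_norm_quadGaussSum {q : ℕ} [NeZero q] {a m : ℤ} (ha : IsCoprime a q)
    (h0 : (q : ℤ) ≡ 0 [ZMOD 4] → Even m) (h2 : (q : ℤ) ≡ 2 [ZMOD 4] → Odd m) :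
    Real.sqrt q ≤ ‖quadGaussSum q a m‖ := by
  have hu : IsUnit (a : ZMod q) := by
    rw [ZMod.coe_int_isUnit_iff_isCoprime]; exact ha.symm
  have hone : ∀ h : ZMod q, 2 * h = 0 →
      ZMod.stdAddChar ((a : ZMod q) * h ^ 2 + (m : ZMod q) * h) = 1 := by
    intro h hh
    rcases eq_zero_or_two_mul_val_eq hh with h4 | h4
    · simp [h4]
    · set r := h.val with hr
      have hr' : h = ((r : ℤ) : ZMod q) := by simp [hr]
      -- With `q = 2 r` the phase at `h = r` is `r (a r + m) / (2 r)`, an integer by parity.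
      have hev : Even (a * r + m) := by
        rcases Nat.even_or_odd r with hre | hro
        · have hm : Even m := h0 (by
            obtain ⟨c, hc⟩ := hre
            rw [Int.modEq_zero_iff_dvd]
            exact ⟨c, by push_cast [← h4, hc]; ring⟩)
          exact ((by exact_mod_cast hre : Even (r : ℤ)).mul_left a).add hm
        · have hm : Odd m := h2 (by
            obtain ⟨c, hc⟩ := hro
            apply Int.ModEq.symm
            rw [Int.modEq_iff_dvd]
            exact ⟨c, by push_cast [← h4, hc]; ring⟩)
          have hao : Odd a := by
            by_contra hne
            rw [Int.not_odd_iff_even] at hne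
            have h5 : (2 : ℤ) ∣ a := hne.two_dvd
            have h6 : (2 : ℤ) ∣ q := ⟨r, by exact_mod_cast h4.symm⟩
            have := ha.isUnit_of_dvd' h5 h6
            norm_num [Int.isUnit_iff] at this
          exact (hao.mul (by exact_mod_cast hro)).add_odd hm
      obtain ⟨c, hc⟩ := hev
      have hz : (a : ZMod q) * h ^ 2 + (m : ZMod q) * h = 0 := by
        have : (a : ZMod q) * h ^ 2 + (m : ZMod q) * h = ((r * (a * r + m) : ℤ) : ZMod q) := by
          rw [hr']; push_cast; ring
        rw [this, ZMod.intCast_zmod_eq_zero_iff_dvd]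
        refine ⟨c, ?_⟩
        rw [hc, ← h4]; push_cast; ring
      rw [hz, AddChar.map_zero_eq_one]
  have h1 : (q : ℝ) ≤ ‖quadGaussSum q (a : ZMod q) m‖ ^ 2 := by
    have h2 : ‖quadGaussSum q (a : ZMod q) m‖ ^ 2 =
        ‖quadGaussSum q (a : ZMod q) m * (starRingEnd ℂ) (quadGaussSum q (a : ZMod q) m)‖ := by
      rw [norm_mul, RCLike.norm_conj, sq]
    rw [h2, quadGaussSum_mul_conj hu, norm_mul, Complex.norm_natCast]
    refine le_mul_of_one_le_right (by positivity) ?_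
    rw [Finset.sum_congr rfl fun h hh => hone h (Finset.mem_filter.1 hh).2]
    simp only [Finset.sum_const, nsmul_eq_mul, mul_one, Complex.norm_natCast, Nat.one_le_cast]
    exact Finset.card_pos.2 ⟨0, by simp⟩
  rw [Real.sqrt_le_left (norm_nonneg _)]
  exact h1

/-- Geometric sums of additive characters, by Jordan's inequality. -/
lemma norm_sum_range_stdAddChar_mul_le {q : ℕ} [NeZero q] {h : ZMod q} (hh : h ≠ 0) (A : ℤ)
    (L : ℕ) : ‖∑ i ∈ Finset.range L, ZMod.stdAddChar (h * ((A + i : ℤ) : ZMod q))‖ ≤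
      q / 2 * ((h.val : ℝ)⁻¹ + ((q - h.val : ℕ) : ℝ)⁻¹) := by
  have hq : (0 : ℝ) < q := by exact_mod_cast Nat.pos_of_ne_zero (NeZero.ne q)
  have hv : 0 < h.val := Nat.pos_of_ne_zero fun h0 => hh ((ZMod.val_eq_zero h).1 h0)
  have hlt := ZMod.val_lt h
  have hv' : (0 : ℝ) < h.val := by exact_mod_cast hv
  have hw' : (0 : ℝ) < ((q - h.val : ℕ) : ℝ) := by exact_mod_cast Nat.sub_pos_of_lt hlt
  have hcast : ((q - h.val : ℕ) : ℝ) = q - h.val := by push_cast [hlt.le]; ring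
  set z : ℂ := ZMod.stdAddChar h with hz
  have hz1 : ‖z - 1‖ = 2 * Real.sin (Real.pi * h.val / q) := by
    have : z = Complex.exp (Complex.I * ((2 * Real.pi * h.val / q : ℝ) : ℂ)) := by
      have h1 := ZMod.stdAddChar_coe (N := q) (h.val : ℤ)
      have h2 : (((h.val : ℤ)) : ZMod q) = h := by simp
      rw [h2] at h1
      rw [hz, h1]
      congr 1
      push_cast
      ring
    rw [this, Complex.norm_exp_I_mul_ofReal_sub_one, Real.norm_eq_abs, abs_of_nonneg]
    · congr 2; ring
    · have : 0 ≤ Real.sin (2 * Real.pi * h.val / q / 2) := by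
        apply Real.sin_nonneg_of_nonneg_of_le_pi
        · positivity
        · rw [div_div, div_le_iff₀ (by positivity)]
          have : (h.val : ℝ) ≤ q := by exact_mod_cast hlt.le
          nlinarith [Real.pi_pos]
      linarith
  have hzlow : 4 / (q * ((h.val : ℝ)⁻¹ + ((q - h.val : ℕ) : ℝ)⁻¹)) ≤ ‖z - 1‖ := by
    have hmin : ∀ u : ℝ, 0 < u → u ≤ (h.val : ℝ)⁻¹ + ((q - h.val : ℕ) : ℝ)⁻¹ →
        4 / (q * ((h.val : ℝ)⁻¹ + ((q - h.val : ℕ) : ℝ)⁻¹)) ≤ 4 / (q * u) := by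
      intro u hu huu
      gcongr
    rw [hz1]
    rcases le_total (2 * (h.val : ℝ)) q with hc | hc
    · refine (hmin (h.val : ℝ)⁻¹ (by positivity)
        (le_add_of_nonneg_right (by positivity))).trans ?_
      have := Real.mul_le_sin (x := Real.pi * h.val / q) (by positivity) (by
        rw [div_le_div_iff₀ hq (by norm_num)]; nlinarith [Real.pi_pos])
      have h3 : 4 / (q * (h.val : ℝ)⁻¹) = 2 * (2 / Real.pi * (Real.pi * h.val / q)) := by
        field_simp; ring
      rw [h3]; linarith
    · refine (hmin ((q - h.val : ℕ) : ℝ)⁻¹ (by positivity)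
        (le_add_of_nonneg_left (by positivity))).trans ?_
      have h4 : Real.sin (Real.pi * h.val / q) =
          Real.sin (Real.pi * ((q - h.val : ℕ) : ℝ) / q) := by
        rw [← Real.sin_pi_sub]
        congr 1
        rw [hcast]
        field_simp
      rw [h4]
      have := Real.mul_le_sin (x := Real.pi * ((q - h.val : ℕ) : ℝ) / q) (by positivity) (by
        rw [div_le_div_iff₀ hq (by norm_num), hcast]; nlinarith [Real.pi_pos])
      have h3 : 4 / (q * ((q - h.val : ℕ) : ℝ)⁻¹) =
          2 * (2 / Real.pi * (Real.pi * ((q - h.val : ℕ) : ℝ) / q)) := by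
        field_simp; ring
      rw [h3]; linarith
  have hpos : 0 < q * ((h.val : ℝ)⁻¹ + ((q - h.val : ℕ) : ℝ)⁻¹) := by positivity
  have hsum : ∑ i ∈ Finset.range L, ZMod.stdAddChar (h * ((A + i : ℤ) : ZMod q)) =
      ZMod.stdAddChar (h * (A : ZMod q)) * ∑ i ∈ Finset.range L, z ^ i := by
    rw [Finset.mul_sum]
    refine Finset.sum_congr rfl fun i _ => ?_
    rw [hz, ← AddChar.map_nsmul_eq_pow, ← AddChar.map_add_eq_mul]
    congr 1
    push_cast
    rw [nsmul_eq_mul]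
    ring
  have hzn : ‖z - 1‖ ≠ 0 := (lt_of_lt_of_le (by positivity) hzlow).ne'
  have hz2 : z ≠ 1 := fun h1 => hzn (by simp [h1])
  rw [hsum, norm_mul, norm_stdAddChar, one_mul, geom_sum_eq hz2, norm_div]
  have hnum : ‖z ^ L - 1‖ ≤ 2 := by
    refine (norm_sub_le _ _).trans ?_
    rw [norm_pow, hz, norm_stdAddChar]; norm_num
  calc ‖z ^ L - 1‖ / ‖z - 1‖ ≤ 2 / (4 / (q * ((h.val : ℝ)⁻¹ + ((q - h.val : ℕ) : ℝ)⁻¹))) := by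
        gcongr
    _ = _ := by field_simp; ring

lemma sum_inv_val_add_inv_le (q : ℕ) [NeZero q] :
    ∑ h ∈ Finset.univ.erase (0 : ZMod q), ((h.val : ℝ)⁻¹ + ((q - h.val : ℕ) : ℝ)⁻¹) ≤
      2 * (1 + Real.log q) := by
  have hb : ∀ f : ℕ → ℝ, ∑ h : ZMod q, f h.val = ∑ i ∈ Finset.range q, f i := by
    intro f
    obtain ⟨r, rfl⟩ := Nat.exists_eq_succ_of_ne_zero (NeZero.ne q)
    exact Fin.sum_univ_eq_sum_range f (r + 1)
  have hH : ∑ i ∈ Finset.range q, ((i + 1 : ℕ) : ℝ)⁻¹ ≤ 1 + Real.log q := by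
    have := harmonic_le_one_add_log q
    simpa [harmonic] using this
  have h1 : ∑ h ∈ Finset.univ.erase (0 : ZMod q), (h.val : ℝ)⁻¹ ≤ 1 + Real.log q := by
    have h2 : ∑ h ∈ Finset.univ.erase (0 : ZMod q), (h.val : ℝ)⁻¹ ≤
        ∑ h : ZMod q, (h.val : ℝ)⁻¹ :=
      Finset.sum_le_sum_of_subset_of_nonneg (Finset.subset_univ _) fun _ _ _ => by positivity
    refine h2.trans ?_
    rw [hb fun i => (i : ℝ)⁻¹]
    refine le_trans ?_ hH
    obtain ⟨r, rfl⟩ := Nat.exists_eq_succ_of_ne_zero (NeZero.ne q)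
    rw [Finset.sum_range_succ', Finset.sum_range_succ]
    simp only [Nat.cast_zero, inv_zero, add_zero]
    have : (0 : ℝ) ≤ ((r + 1 : ℕ) : ℝ)⁻¹ := by positivity
    linarith
  have h3 : ∑ h ∈ Finset.univ.erase (0 : ZMod q), ((q - h.val : ℕ) : ℝ)⁻¹ ≤ 1 + Real.log q := by
    have h2 : ∑ h ∈ Finset.univ.erase (0 : ZMod q), ((q - h.val : ℕ) : ℝ)⁻¹ ≤
        ∑ h : ZMod q, ((q - h.val : ℕ) : ℝ)⁻¹ :=
      Finset.sum_le_sum_of_subset_of_nonneg (Finset.subset_univ _) fun _ _ _ => by positivity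
    refine h2.trans ?_
    rw [hb fun i => ((q - i : ℕ) : ℝ)⁻¹, ← Finset.sum_range_reflect]
    refine le_trans (le_of_eq (Finset.sum_congr rfl fun i hi => ?_)) hH
    rw [Finset.mem_range] at hi
    congr 2
    omega
  rw [Finset.sum_add_distrib]
  linarith

/-- Incomplete Gauss sums by completion: a sum over `L` consecutive integers is `L / q` times the
complete sum, up to `O(√q log q)`. -/
lemma norm_sum_range_sub_quadGaussSum_le {q : ℕ} [NeZero q] {a : ZMod q} (ha : IsUnit a)
    (m : ZMod q) (A : ℤ) (L : ℕ) :
    ‖∑ i ∈ Finset.range L, ZMod.stdAddChar (a * ((A + i : ℤ) : ZMod q) ^ 2 +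
        m * ((A + i : ℤ) : ZMod q)) - (L / q : ℂ) * quadGaussSum q a m‖ ≤
      Real.sqrt (2 * q) * (1 + Real.log q) := by
  have hq : (0 : ℝ) < q := by exact_mod_cast Nat.pos_of_ne_zero (NeZero.ne q)
  have hqc : (q : ℂ) ≠ 0 := by exact_mod_cast hq.ne'
  -- Fourier inversion on `ZMod q`: the transform of a quadratic phase is again a Gauss sum.
  have hinv : ∀ x : ZMod q, ZMod.stdAddChar (a * x ^ 2 + m * x) =
      (q : ℂ)⁻¹ * ∑ h : ZMod q, ZMod.stdAddChar (h * x) * quadGaussSum q a (m - h) := by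
    intro x
    have h1 : ∑ h : ZMod q, ZMod.stdAddChar (h * x) * quadGaussSum q a (m - h) =
        ∑ y : ZMod q, ZMod.stdAddChar (a * y ^ 2 + m * y) *
          ∑ h : ZMod q, ZMod.stdAddChar (h * (x - y)) := by
      simp only [quadGaussSum, Finset.mul_sum]
      rw [Finset.sum_comm]
      refine Finset.sum_congr rfl fun y _ => Finset.sum_congr rfl fun h _ => ?_
      rw [← AddChar.map_add_eq_mul, ← AddChar.map_add_eq_mul]
      congr 1
      ring
    rw [h1]
    simp_rw [AddChar.sum_mulShift _ (ZMod.isPrimitive_stdAddChar q), sub_eq_zero]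
    simp only [ZMod.card, Nat.cast_ite, Nat.cast_zero, mul_ite, mul_zero, Finset.sum_ite_eq,
      Finset.mem_univ, if_true]
    field_simp
  have hsum : ∑ i ∈ Finset.range L, ZMod.stdAddChar (a * ((A + i : ℤ) : ZMod q) ^ 2 +
        m * ((A + i : ℤ) : ZMod q)) = (q : ℂ)⁻¹ * ∑ h : ZMod q, quadGaussSum q a (m - h) *
          ∑ i ∈ Finset.range L, ZMod.stdAddChar (h * ((A + i : ℤ) : ZMod q)) := by
    simp_rw [hinv]
    rw [← Finset.mul_sum, Finset.sum_comm]
    congr 1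
    refine Finset.sum_congr rfl fun h _ => ?_
    rw [Finset.mul_sum]
    exact Finset.sum_congr rfl fun i _ => mul_comm _ _
  rw [hsum, ← Finset.add_sum_erase _ _ (Finset.mem_univ (0 : ZMod q))]
  have h0 : quadGaussSum q a (m - 0) * ∑ i ∈ Finset.range L,
      ZMod.stdAddChar ((0 : ZMod q) * ((A + i : ℤ) : ZMod q)) = L * quadGaussSum q a m := by
    simp [mul_comm]
  rw [h0, mul_add, show (q : ℂ)⁻¹ * (L * quadGaussSum q a m) = (L / q : ℂ) * quadGaussSum q a m by
    ring, add_sub_cancel_left, norm_mul, norm_inv, Complex.norm_natCast]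
  have hS : ‖∑ h ∈ Finset.univ.erase (0 : ZMod q), quadGaussSum q a (m - h) *
      ∑ i ∈ Finset.range L, ZMod.stdAddChar (h * ((A + i : ℤ) : ZMod q))‖ ≤
      Real.sqrt (2 * q) * (q / 2) * (2 * (1 + Real.log q)) := by
    refine (norm_sum_le _ _).trans ?_
    refine (Finset.sum_le_sum (g := fun h : ZMod q => Real.sqrt (2 * q) * (q / 2) *
      ((h.val : ℝ)⁻¹ + ((q - h.val : ℕ) : ℝ)⁻¹)) fun h hh => ?_).trans ?_
    · rw [norm_mul, mul_assoc (Real.sqrt (2 * q))]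
      exact mul_le_mul (norm_quadGaussSum_le ha _)
        (norm_sum_range_stdAddChar_mul_le (Finset.ne_of_mem_erase hh) A L) (norm_nonneg _)
        (by positivity)
    · rw [← Finset.mul_sum]
      exact mul_le_mul_of_nonneg_left (sum_inv_val_add_inv_le q) (by positivity)
  calc (q : ℝ)⁻¹ * _ ≤ (q : ℝ)⁻¹ * (Real.sqrt (2 * q) * (q / 2) * (2 * (1 + Real.log q))) := by
        gcongr
    _ = _ := by field_simp

/-- Summation by parts with slowly varying weights. -/
lemma norm_sum_mul_sub_le (G w : ℕ → ℂ) {P v : ℝ} (L : ℕ)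
    (hP : ∀ j ≤ L, ‖∑ i ∈ Finset.range j, G i‖ ≤ P) (hv : ∀ i < L, ‖w (i + 1) - w i‖ ≤ v) :
    ‖∑ i ∈ Finset.range L, G i * w i - (∑ i ∈ Finset.range L, G i) * w L‖ ≤ L * (P * v) := by
  induction L with
  | zero => simp
  | succ L ih =>
    have h1 := ih (fun j hj => hP j (by omega)) (fun i hi => hv i (by omega))
    have h2 : ∑ i ∈ Finset.range (L + 1), G i * w i - (∑ i ∈ Finset.range (L + 1), G i) * w (L + 1)
        = (∑ i ∈ Finset.range L, G i * w i - (∑ i ∈ Finset.range L, G i) * w L) -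
          (∑ i ∈ Finset.range (L + 1), G i) * (w (L + 1) - w L) := by
      simp only [Finset.sum_range_succ]; ring
    rw [h2]
    refine (norm_sub_le _ _).trans ?_
    rw [norm_mul]
    have h3 : ‖∑ i ∈ Finset.range (L + 1), G i‖ * ‖w (L + 1) - w L‖ ≤ P * v :=
      mul_le_mul (hP _ le_rfl) (hv L (by omega)) (norm_nonneg _)
        ((norm_nonneg _).trans (hP _ le_rfl))
    push_cast
    linarith

/-- A long quadratic exponential sum at an admissible rational point, with slowly varying weights,
keeps the full size `L / √q`. -/
lemma div_sqrt_le_norm_weighted_gauss {q : ℕ} [NeZero q] {a m : ℤ} (ha : IsCoprime a q)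
    (h0 : (q : ℤ) ≡ 0 [ZMOD 4] → Even m) (h2 : (q : ℤ) ≡ 2 [ZMOD 4] → Odd m)
    (A : ℤ) (L : ℕ) (w : ℕ → ℂ) {v : ℝ} (hw : 1 / 2 ≤ ‖w L‖)
    (hv : ∀ i < L, ‖w (i + 1) - w i‖ ≤ v) (hLv : L * v ≤ 1 / 16)
    (hE : 4 * Real.sqrt 2 * q * (1 + Real.log q) ≤ L) :
    L / (4 * Real.sqrt q) ≤
      ‖∑ i ∈ Finset.range L, e (2 * Real.pi * (a * (A + i) ^ 2 + m * (A + i)) / q) * w i‖ := by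
  have hu : IsUnit (a : ZMod q) := by
    rw [ZMod.coe_int_isUnit_iff_isCoprime]; exact ha.symm
  have hq : (0 : ℝ) < q := by exact_mod_cast Nat.pos_of_ne_zero (NeZero.ne q)
  have hs : 0 < Real.sqrt q := Real.sqrt_pos.2 hq
  have hss : Real.sqrt q * Real.sqrt q = q := Real.mul_self_sqrt hq.le
  set G : ℕ → ℂ := fun i => e (2 * Real.pi * (a * (A + i) ^ 2 + m * (A + i)) / q) with hG
  have hGz : ∀ i, G i = ZMod.stdAddChar ((a : ZMod q) * ((A + i : ℤ) : ZMod q) ^ 2 +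
        (m : ZMod q) * ((A + i : ℤ) : ZMod q)) := by
    intro i
    have h1 := ZMod.stdAddChar_coe (N := q) (a * (A + i) ^ 2 + m * (A + i))
    push_cast at h1 ⊢
    rw [h1, hG]
    simp only [e]
    congr 1
    push_cast
    ring
  set E := Real.sqrt (2 * q) * (1 + Real.log q) with hEdef
  have hsqrt2q : Real.sqrt (2 * q) = Real.sqrt 2 * Real.sqrt q := Real.sqrt_mul (by norm_num) _
  have hEle : E ≤ L / (4 * Real.sqrt q) := by
    rw [le_div_iff₀ (by positivity), hEdef, hsqrt2q]
    calc _ = 4 * Real.sqrt 2 * (Real.sqrt q * Real.sqrt q) * (1 + Real.log q) := by ring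
      _ ≤ L := by rw [hss]; exact hE
  have hcomp : ∀ j : ℕ, ‖∑ i ∈ Finset.range j, G i - (j / q : ℂ) * quadGaussSum q a m‖ ≤ E := by
    intro j
    simp_rw [hGz]
    exact norm_sum_range_sub_quadGaussSum_le hu _ A j
  have hnorm : ∀ j : ℕ, ‖(j / q : ℂ) * quadGaussSum q a m‖ = j / q * ‖quadGaussSum q a m‖ := by
    intro j
    simp
  have hLs : (L : ℝ) / q * Real.sqrt q = L / Real.sqrt q := by
    rw [div_mul_eq_mul_div, div_eq_div_iff hq.ne' hs.ne', mul_assoc, hss]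
  have hlow : L / Real.sqrt q - E ≤ ‖∑ i ∈ Finset.range L, G i‖ := by
    have h1 := norm_sub_norm_le ((L / q : ℂ) * quadGaussSum q a m)
      ((L / q : ℂ) * quadGaussSum q a m - ∑ i ∈ Finset.range L, G i)
    rw [sub_sub_cancel, norm_sub_rev _ (∑ i ∈ Finset.range L, G i), hnorm] at h1
    have h3 := hcomp L
    have h4 := mul_le_mul_of_nonneg_left (sqrt_le_norm_quadGaussSum ha h0 h2)
      (show 0 ≤ (L : ℝ) / q by positivity)
    rw [hLs] at h4
    linarith
  have hL0 : 0 ≤ (L : ℝ) / Real.sqrt q := by positivity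
  have hquarter : (L : ℝ) / (4 * Real.sqrt q) = (L / Real.sqrt q) / 4 := by
    rw [div_div, mul_comm]
  rw [hquarter] at hEle ⊢
  have hsq2 : Real.sqrt 2 ≤ 3 / 2 := by
    rw [Real.sqrt_le_left (by norm_num)]; norm_num
  have hP : ∀ j ≤ L, ‖∑ i ∈ Finset.range j, G i‖ ≤ 2 * (L / Real.sqrt q) := by
    intro j hj
    have h1 := norm_le_norm_add_norm_sub ((j / q : ℂ) * quadGaussSum q a m)
      (∑ i ∈ Finset.range j, G i)
    rw [hnorm] at h1
    have h3 := hcomp j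
    rw [norm_sub_rev] at h1
    have hj' : (j : ℝ) ≤ L := by exact_mod_cast hj
    have h4 : (j : ℝ) / q * ‖quadGaussSum q a m‖ ≤ L / q * (3 / 2 * Real.sqrt q) := by
      have := norm_quadGaussSum_le hu (m : ZMod q)
      rw [hsqrt2q] at this
      have h5 : ‖quadGaussSum q (a : ZMod q) m‖ ≤ 3 / 2 * Real.sqrt q :=
        this.trans (by gcongr)
      gcongr
    have h5 : (L : ℝ) / q * (3 / 2 * Real.sqrt q) = 3 / 2 * (L / Real.sqrt q) := by
      rw [← hLs]; ring
    linarith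
  have habel := norm_sum_mul_sub_le G w L hP hv
  have h5 : (L : ℝ) * (2 * (L / Real.sqrt q) * v) ≤ (L / Real.sqrt q) / 8 := by
    calc _ = 2 * (L / Real.sqrt q) * (L * v) := by ring
      _ ≤ 2 * (L / Real.sqrt q) * (1 / 16) := by gcongr
      _ = _ := by ring
  have h6 := norm_sub_norm_le ((∑ i ∈ Finset.range L, G i) * w L)
    ((∑ i ∈ Finset.range L, G i) * w L - ∑ i ∈ Finset.range L, G i * w i)
  rw [sub_sub_cancel, norm_sub_rev _ (∑ i ∈ Finset.range L, G i * w i), norm_mul] at h6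
  have h7 : 3 / 4 * (L / Real.sqrt q) * (1 / 2) ≤ ‖∑ i ∈ Finset.range L, G i‖ * ‖w L‖ := by
    gcongr
    linarith
  linarith

/-! ### The Fourier transform of the building blocks -/

/-- The profile `φ̂`, as a complex Schwartz function. -/
def profile (φ : 𝓢(ℝ, ℝ)) : 𝓢(ℝ, ℂ) := 𝓕 (φ.postcompCLM Complex.ofRealCLM)

lemma profile_eq_zero {φ : 𝓢(ℝ, ℝ)}
    (hφ : tsupport (𝓕 (fun y : ℝ => ((φ y : ℝ) : ℂ))) ⊆ Metric.ball (0 : ℝ) 1) {η : ℝ}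
    (hη : 1 ≤ |η|) : profile φ η = 0 := by
  have h1 : (profile φ : ℝ → ℂ) = 𝓕 (fun y : ℝ => ((φ y : ℝ) : ℂ)) := by
    unfold profile
    rw [SchwartzMap.fourier_coe]
    rfl
  rw [h1]
  refine image_eq_zero_of_notMem_tsupport fun h => ?_
  have := hφ h
  rw [Metric.mem_ball, dist_zero_right, Real.norm_eq_abs] at this
  linarith

/-- Fourier inversion for the profile. -/
lemma packet_profile_zero (φ : 𝓢(ℝ, ℝ)) (y : ℝ) : packet (profile φ) 0 y = (φ y : ℂ) := by
  have h1 : 𝓕⁻ (profile φ) y = (φ y : ℂ) := by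
    unfold profile
    rw [FourierTransform.fourierInv_fourier_eq]
    simp
  rw [← h1, SchwartzMap.fourierInv_coe, Real.fourierInv_eq']
  unfold packet e
  refine integral_congr_ae (Eventually.of_forall fun η => ?_)
  simp only [smul_eq_mul, Real.inner_apply]
  rw [mul_comm]
  congr 2
  push_cast
  ring

/-- The Fourier transform of `firstFactor`. -/
def firstHat (ψ : 𝓢(ℝ, ℂ)) (R ξ : ℝ) : ℂ := (Real.sqrt R : ℂ)⁻¹ * ψ ((ξ - R) / Real.sqrt R)

/-- The Fourier transform of `otherFactor`. -/
def otherHat (ψ : 𝓢(ℝ, ℂ)) (R D ξ : ℝ) : ℂ := ∑ l ∈ freqs R D, ψ (ξ - D * l)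

/-- The Fourier transform of the `j`-th factor of `fD`. -/
def factorHat {n : ℕ} [NeZero n] (ψ : 𝓢(ℝ, ℂ)) (R D : ℝ) (j : Fin n) : ℝ → ℂ :=
  if j = 0 then firstHat ψ R else otherHat ψ R D

/-- One-dimensional Schrödinger evolution with a sharp frequency cut-off, on the Fourier side. -/
def cutFlow (G : ℝ → ℂ) (N t x : ℝ) : ℂ :=
  ∫ ξ in (-(N / 2))..(N / 2), G ξ * e (-Real.pi * t * ξ ^ 2 + 2 * Real.pi * x * ξ)

lemma cutFlow_firstHat (ψ : 𝓢(ℝ, ℂ)) {R : ℝ} (hR : 0 < R) (N t x : ℝ) :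
    cutFlow (firstHat ψ R) N t x = e (-Real.pi * t * R ^ 2 + 2 * Real.pi * x * R) *
      cutPacket ψ (-(N / 2) / Real.sqrt R - Real.sqrt R) (N / 2 / Real.sqrt R - Real.sqrt R)
        (t * R) (Real.sqrt R * (x - t * R)) := by
  have hs : 0 < Real.sqrt R := Real.sqrt_pos.2 hR
  have hss : Real.sqrt R * Real.sqrt R = R := Real.mul_self_sqrt hR.le
  unfold cutPacket
  rw [← intervalIntegral.inv_smul_integral_comp_div_sub, cutFlow, ← intervalIntegral.integral_smul,
    ← intervalIntegral.integral_const_mul]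
  refine intervalIntegral.integral_congr fun ξ _ => ?_
  set s := Real.sqrt R with hsdef
  have hη : (ξ - R) / s = ξ / s - s := by
    rw [sub_div]; congr 1; rw [div_eq_iff hs.ne', hss]
  have hξ : ξ = R + s * (ξ / s - s) := by
    rw [← hη, mul_div_cancel₀ _ hs.ne']; ring
  simp only [firstHat]
  rw [← hsdef, hη]
  set η := ξ / s - s
  have hph : -Real.pi * t * ξ ^ 2 + 2 * Real.pi * x * ξ =
      (-Real.pi * t * R ^ 2 + 2 * Real.pi * x * R) +
      (-Real.pi * (t * R) * η ^ 2 + 2 * Real.pi * (s * (x - t * R)) * η) := by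
    rw [hξ, ← hss]; ring
  rw [hph, e_add, Complex.real_smul]
  push_cast
  ring

lemma cutFlow_otherHat (ψ : 𝓢(ℝ, ℂ)) (R D N t x : ℝ) :
    cutFlow (otherHat ψ R D) N t x = ∑ l ∈ freqs R D,
      e (-Real.pi * t * (D * l) ^ 2 + 2 * Real.pi * x * (D * l)) *
        cutPacket ψ (-(N / 2) - D * l) (N / 2 - D * l) t (x - t * (D * l)) := by
  unfold cutFlow otherHat
  simp_rw [Finset.sum_mul]
  rw [intervalIntegral.integral_finsetSum fun l _ => ?_]
  · refine Finset.sum_congr rfl fun l _ => ?_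
    unfold cutPacket
    rw [← intervalIntegral.integral_comp_sub_right, ← intervalIntegral.integral_const_mul]
    refine intervalIntegral.integral_congr fun ξ _ => ?_
    have hph : -Real.pi * t * ξ ^ 2 + 2 * Real.pi * x * ξ =
        (-Real.pi * t * (D * l) ^ 2 + 2 * Real.pi * x * (D * l)) +
        (-Real.pi * t * (ξ - D * l) ^ 2 + 2 * Real.pi * (x - t * (D * l)) * (ξ - D * l)) := by
      ring
    simp only [hph, e_add]
    ring
  · have h1 := ψ.continuous
    have h2 := continuous_e
    exact Continuous.intervalIntegrable (by fun_prop) _ _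

/-- The evolution factorises over the coordinates. -/
lemma setIntegral_cube_prod {n : ℕ} (G : Fin n → ℝ → ℂ) {N : ℝ} (hN : 0 ≤ N) (t : ℝ)
    (x : EuclideanSpace ℝ (Fin n)) :
    ∫ ξ in cube n N, (∏ j, G j (ξ j)) *
        e (-Real.pi * t * ‖ξ‖ ^ 2 + 2 * Real.pi * inner ℝ x ξ) =
      ∏ j, cutFlow (G j) N t (x j) := by
  have hmeas : MeasurableSet (cube n N) := by
    have : cube n N = ⋂ j, {ξ : EuclideanSpace ℝ (Fin n) | |ξ j| ≤ N / 2} := by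
      ext; simp [cube]
    rw [this]
    exact MeasurableSet.iInter fun j =>
      measurableSet_le (by fun_prop) measurable_const
  rw [← integral_indicator hmeas]
  have h1 : ∀ ξ : EuclideanSpace ℝ (Fin n), (cube n N).indicator (fun ξ => (∏ j, G j (ξ j)) *
        e (-Real.pi * t * ‖ξ‖ ^ 2 + 2 * Real.pi * inner ℝ x ξ)) ξ =
      ∏ j, (Set.Icc (-(N / 2)) (N / 2)).indicator (fun η => G j η *
        e (-Real.pi * t * η ^ 2 + 2 * Real.pi * x j * η)) (ξ j) := by
    intro ξ
    classical
    simp only [Set.indicator_apply, Finset.prod_ite_zero, Finset.mem_univ, true_implies,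
      Finset.prod_mul_distrib, ← e_sum]
    have hc : ξ ∈ cube n N ↔ ∀ j, ξ j ∈ Set.Icc (-(N / 2)) (N / 2) := by
      simp only [cube, Set.mem_ofPred_eq, abs_le, Set.mem_Icc]
    simp only [hc]
    congr 3
    rw [Finset.sum_add_distrib, ← Finset.mul_sum, EuclideanSpace.norm_sq_eq]
    simp only [PiLp.inner_apply, Real.norm_eq_abs, sq_abs, Real.inner_apply, Finset.mul_sum]
    congr 1
    exact Finset.sum_congr rfl fun j _ => by ring
  simp_rw [h1]
  rw [← (PiLp.volume_preserving_toLp (Fin n)).integral_comp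
    (MeasurableEquiv.toLp 2 (Fin n → ℝ)).measurableEmbedding]
  rw [integral_fintype_prod_volume_eq_prod (fun j => (Set.Icc (-(N / 2)) (N / 2)).indicator
    (fun η => G j η * e (-Real.pi * t * η ^ 2 + 2 * Real.pi * x j * η)))]
  refine Finset.prod_congr rfl fun j _ => ?_
  rw [integral_indicator measurableSet_Icc, integral_Icc_eq_integral_Ioc,
    ← intervalIntegral.integral_of_le (by linarith), cutFlow]

section Profile

variable {ψ : 𝓢(ℝ, ℂ)}

lemma firstHat_eq_zero (hψ : ∀ η, 1 ≤ |η| → ψ η = 0) {R ξ : ℝ} (hR : 1 ≤ R) (h : 2 * R < |ξ|) :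
    firstHat ψ R ξ = 0 := by
  have hs0 : 0 < Real.sqrt R := Real.sqrt_pos.2 (by linarith)
  have hs : Real.sqrt R ≤ R := by
    rw [Real.sqrt_le_left (by linarith)]; nlinarith
  unfold firstHat
  rw [hψ, mul_zero]
  rw [abs_div, abs_of_pos hs0, one_le_div hs0]
  have := abs_sub_abs_le_abs_sub ξ R
  rw [abs_of_pos (show 0 < R by linarith)] at this
  linarith

lemma mul_lt_of_mem_freqs {R D : ℝ} (hD : 0 < D) {l : ℤ} (hl : l ∈ freqs R D) :
    R / 2 < D * l ∧ D * l < R := by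
  rw [mem_freqs] at hl
  rw [div_lt_iff₀ (by positivity), lt_div_iff₀ hD] at hl
  constructor <;> nlinarith [hl.1, hl.2]

lemma otherHat_eq_zero (hψ : ∀ η, 1 ≤ |η| → ψ η = 0) {R D ξ : ℝ} (hR : 1 ≤ R) (hD : 0 < D)
    (h : 2 * R < |ξ|) : otherHat ψ R D ξ = 0 := by
  unfold otherHat
  refine Finset.sum_eq_zero fun l hl => hψ _ ?_
  obtain ⟨h1, h2⟩ := mul_lt_of_mem_freqs hD hl
  have := abs_sub_abs_le_abs_sub ξ (D * l)
  rw [abs_of_pos (show 0 < D * (l : ℝ) by linarith)] at this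
  linarith

lemma factorHat_eq_zero {n : ℕ} [NeZero n] (hψ : ∀ η, 1 ≤ |η| → ψ η = 0) {R D ξ : ℝ} (hR : 1 ≤ R)
    (hD : 0 < D) (h : 2 * R < |ξ|) (j : Fin n) : factorHat ψ R D j ξ = 0 := by
  unfold factorHat
  split_ifs
  · exact firstHat_eq_zero hψ hR h
  · exact otherHat_eq_zero hψ hR hD h

lemma contDiff_factorHat {n : ℕ} [NeZero n] (ψ : 𝓢(ℝ, ℂ)) (R D : ℝ) (j : Fin n) :
    ContDiff ℝ (⊤ : ℕ∞) (factorHat ψ R D j) := by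
  have h1 := ψ.smooth ⊤
  unfold factorHat firstHat otherHat
  split_ifs
  · fun_prop
  · fun_prop

lemma prod_factorHat_eq_zero {n : ℕ} [NeZero n] (hψ : ∀ η, 1 ≤ |η| → ψ η = 0) {R D : ℝ}
    (hR : 1 ≤ R) (hD : 0 < D) {N : ℝ} (hN : 4 * R ≤ N) {ξ : EuclideanSpace ℝ (Fin n)}
    (hξ : ξ ∉ cube n N) : ∏ j, factorHat ψ R D j (ξ j) = 0 := by
  simp only [cube, Set.mem_ofPred_eq, not_forall, not_le] at hξ
  obtain ⟨j, hj⟩ := hξ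
  exact Finset.prod_eq_zero (Finset.mem_univ j) (factorHat_eq_zero hψ hR hD (by linarith) j)

lemma isCompact_cube (n : ℕ) (N : ℝ) : IsCompact (cube n N) := by
  have h1 : cube n N = (EuclideanSpace.equiv (Fin n) ℝ).toHomeomorph ⁻¹'
      (Set.univ.pi fun _ => Set.Icc (-(N / 2)) (N / 2)) := by
    ext ξ
    rw [Set.mem_preimage, Set.mem_univ_pi]
    exact forall_congr' fun j => abs_le
  rw [h1, Homeomorph.isCompact_preimage]
  exact isCompact_univ_pi fun _ => isCompact_Icc

/-- The Fourier transform of `fD`, a smooth function with compact support. -/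
def fDHat {n : ℕ} [NeZero n] (hψ : ∀ η, 1 ≤ |η| → ψ η = 0) {R D : ℝ} (hR : 1 ≤ R) (hD : 0 < D) :
    𝓢(EuclideanSpace ℝ (Fin n), ℂ) :=
  HasCompactSupport.toSchwartzMap
    (f := fun ξ : EuclideanSpace ℝ (Fin n) => ∏ j, factorHat ψ R D j (ξ j))
    (HasCompactSupport.intro (isCompact_cube n (4 * R)) fun _ hξ =>
      prod_factorHat_eq_zero hψ hR hD le_rfl hξ)
    (by
      have h1 := fun j => contDiff_factorHat (n := n) ψ R D j
      refine contDiff_prod fun j _ => (h1 j).comp ?_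
      fun_prop)

lemma fDHat_apply {n : ℕ} [NeZero n] (hψ : ∀ η, 1 ≤ |η| → ψ η = 0) {R D : ℝ} (hR : 1 ≤ R)
    (hD : 0 < D) (ξ : EuclideanSpace ℝ (Fin n)) :
    fDHat hψ hR hD ξ = ∏ j, factorHat ψ R D j (ξ j) := rfl

lemma cutFlow_firstHat_eq (hψ : ∀ η, 1 ≤ |η| → ψ η = 0) {R : ℝ} (hR : 1 ≤ R) {N : ℝ}
    (hN : 4 * R ≤ N) (t x : ℝ) :
    cutFlow (firstHat ψ R) N t x = e (-Real.pi * t * R ^ 2 + 2 * Real.pi * x * R) *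
      packet ψ (t * R) (Real.sqrt R * (x - t * R)) := by
  have hs : 1 ≤ Real.sqrt R := by simpa using Real.sqrt_le_sqrt hR
  have hss : Real.sqrt R * Real.sqrt R = R := Real.mul_self_sqrt (by linarith)
  have h2 : 2 * Real.sqrt R ≤ N / 2 / Real.sqrt R := by
    rw [le_div_iff₀ (by linarith)]; linarith
  rw [cutFlow_firstHat ψ (by linarith), cutPacket_eq_packet hψ]
  · rw [neg_div]; linarith
  · linarith

lemma cutFlow_otherHat_eq (hψ : ∀ η, 1 ≤ |η| → ψ η = 0) {R D : ℝ} (hR : 1 ≤ R) (hD : 0 < D) {N : ℝ}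
    (hN : 4 * R ≤ N) (t x : ℝ) :
    cutFlow (otherHat ψ R D) N t x = ∑ l ∈ freqs R D,
      e (-Real.pi * t * (D * l) ^ 2 + 2 * Real.pi * x * (D * l)) *
        packet ψ t (x - t * (D * l)) := by
  rw [cutFlow_otherHat]
  refine Finset.sum_congr rfl fun l hl => ?_
  obtain ⟨h1, h2⟩ := mul_lt_of_mem_freqs hD hl
  rw [cutPacket_eq_packet hψ] <;> linarith

end Profile

section Datum

variable {φ : 𝓢(ℝ, ℝ)}

/-- Fourier inversion for `fD`. -/
lemma fourierInv_fDHat {n : ℕ} [NeZero n] (hψ : ∀ η, 1 ≤ |η| → profile φ η = 0) {R D : ℝ}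
    (hR : 1 ≤ R) (hD : 0 < D) (x : EuclideanSpace ℝ (Fin n)) :
    𝓕⁻ (fDHat (n := n) hψ hR hD) x = fD φ R D x := by
  have h1 : 𝓕⁻ (fDHat (n := n) hψ hR hD) x =
      ∏ j, cutFlow (factorHat (profile φ) R D j) (4 * R) 0 (x j) := by
    rw [← setIntegral_cube_prod _ (by linarith), SchwartzMap.fourierInv_coe, Real.fourierInv_eq',
      setIntegral_eq_integral_of_forall_compl_eq_zero]
    · refine integral_congr_ae (Eventually.of_forall fun ξ => ?_)
      simp only [smul_eq_mul, fDHat_apply, e]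
      rw [mul_comm, real_inner_comm]
      congr 2
      push_cast
      ring
    · intro ξ hξ
      rw [prod_factorHat_eq_zero hψ hR hD le_rfl hξ, zero_mul]
  rw [h1, fD, ← Finset.mul_prod_erase _ _ (Finset.mem_univ (0 : Fin n))]
  congr 1
  · simp only [factorHat, if_true]
    rw [cutFlow_firstHat_eq hψ hR le_rfl]
    simp only [zero_mul, sub_zero, mul_zero, zero_add, packet_profile_zero, firstFactor]
    congr 2
    ring
  · refine Finset.prod_congr rfl fun j hj => ?_
    simp only [factorHat, if_neg (Finset.ne_of_mem_erase hj)]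
    rw [cutFlow_otherHat_eq hψ hR hD le_rfl]
    simp only [zero_mul, sub_zero, mul_zero, zero_add, packet_profile_zero, otherFactor]
    rw [Finset.mul_sum]
    refine Finset.sum_congr rfl fun l _ => ?_
    rw [mul_comm]
    congr 2
    ring

lemma toLp_fD_eq {n : ℕ} [NeZero n] (hψ : ∀ η, 1 ≤ |η| → profile φ η = 0) {R D : ℝ}
    (hR : 1 ≤ R) (hD : 0 < D) (h : MemLp (fD (n := n) φ R D) 2) :
    h.toLp = (𝓕⁻ (fDHat (n := n) hψ hR hD)).toLp 2 := by
  refine MemLp.toLp_congr _ _ (Eventually.of_forall fun x => ?_)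
  exact (fourierInv_fDHat hψ hR hD x).symm

lemma fourier_toLp_fD {n : ℕ} [NeZero n] (hψ : ∀ η, 1 ≤ |η| → profile φ η = 0) {R D : ℝ}
    (hR : 1 ≤ R) (hD : 0 < D) (h : MemLp (fD (n := n) φ R D) 2) :
    𝓕 (h.toLp : L2 n) = (fDHat (n := n) hψ hR hD).toLp 2 := by
  rw [toLp_fD_eq hψ hR hD, SchwartzMap.toLp_fourier_eq, FourierTransform.fourier_fourierInv_eq]

lemma truncatedFlow_toLp_fD {n : ℕ} [NeZero n] (hψ : ∀ η, 1 ≤ |η| → profile φ η = 0) {R D : ℝ}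
    (hR : 1 ≤ R) (hD : 0 < D) (h : MemLp (fD (n := n) φ R D) 2) {N : ℝ} (hN : 0 ≤ N) (t : ℝ)
    (x : EuclideanSpace ℝ (Fin n)) :
    truncatedFlow (h.toLp : L2 n) N t x =
      ∏ j, cutFlow (factorHat (profile φ) R D j) N t (x j) := by
  rw [← setIntegral_cube_prod _ hN, truncatedFlow, fourier_toLp_fD hψ hR hD]
  refine integral_congr_ae (ae_restrict_of_ae ?_)
  filter_upwards [SchwartzMap.coeFn_toLp (fDHat (n := n) hψ hR hD) 2 volume] with ξ hξ
  rw [hξ, fDHat_apply]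

/-! ### The norm of the building blocks -/

lemma integral_norm_sq_firstHat (ψ : 𝓢(ℝ, ℂ)) {R : ℝ} (hR : 0 < R) :
    ∫ ξ, ‖firstHat ψ R ξ‖ ^ 2 = (Real.sqrt R)⁻¹ * ∫ η, ‖ψ η‖ ^ 2 := by
  have hs : 0 < Real.sqrt R := Real.sqrt_pos.2 hR
  simp only [firstHat, norm_mul, mul_pow]
  rw [integral_const_mul, integral_sub_right_eq_self (fun ξ => ‖ψ (ξ / Real.sqrt R)‖ ^ 2) R,
    Measure.integral_comp_div (fun ξ => ‖ψ ξ‖ ^ 2), abs_of_pos hs]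
  simp only [norm_inv, Complex.norm_real, Real.norm_eq_abs, abs_of_pos hs, smul_eq_mul]
  field_simp

/-- The frequency packets of `otherFactor` are disjoint as soon as `D ≥ 2`. -/
lemma integral_norm_sq_otherHat {ψ : 𝓢(ℝ, ℂ)} (hψ : ∀ η, 1 ≤ |η| → ψ η = 0) (R : ℝ) {D : ℝ}
    (hD : 2 ≤ D) :
    ∫ ξ, ‖otherHat ψ R D ξ‖ ^ 2 = (freqs R D).card * ∫ η, ‖ψ η‖ ^ 2 := by
  have h1 : ∀ ξ, ‖otherHat ψ R D ξ‖ ^ 2 = ∑ l ∈ freqs R D, ‖ψ (ξ - D * l)‖ ^ 2 := by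
    intro ξ
    unfold otherHat
    by_cases h : ∃ l ∈ freqs R D, ψ (ξ - D * l) ≠ 0
    · obtain ⟨l, hl, hne⟩ := h
      have h2 : ∀ m ∈ freqs R D, m ≠ l → ψ (ξ - D * m) = 0 := by
        intro m _ hm
        refine hψ _ ?_
        have h3 : |ξ - D * l| < 1 := by
          by_contra! h4
          exact hne (hψ _ h4)
        have h5 : (1 : ℝ) ≤ |(l : ℝ) - m| := by
          exact_mod_cast Int.one_le_abs (sub_ne_zero.2 (Ne.symm hm))
        have h6 : D * 1 ≤ |D * ((l : ℝ) - m)| := by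
          rw [abs_mul, abs_of_pos (by linarith : 0 < D)]
          gcongr
        have h7 : D * ((l : ℝ) - m) = (ξ - D * m) - (ξ - D * l) := by ring
        rw [h7] at h6
        have := abs_sub (ξ - D * m) (ξ - D * l)
        linarith
      rw [Finset.sum_eq_single_of_mem l hl h2, Finset.sum_eq_single_of_mem l hl]
      intro m hm hml
      rw [h2 m hm hml]; simp
    · push Not at h
      rw [Finset.sum_eq_zero h, Finset.sum_eq_zero fun l hl => by rw [h l hl]; simp]
      simp
  simp_rw [h1]
  have hi : Integrable (fun η => ‖ψ η‖ ^ 2) :=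
    (memLp_two_iff_integrable_sq_norm ψ.continuous.aestronglyMeasurable).1 (ψ.memLp 2)
  rw [integral_finsetSum _ fun l _ => hi.comp_sub_right _]
  simp_rw [integral_sub_right_eq_self (fun ξ => ‖ψ ξ‖ ^ 2)]
  simp

lemma norm_sq_toLp_two {E : Type*} [NormedAddCommGroup E] [NormedSpace ℝ E] [MeasurableSpace E]
    [BorelSpace E] [SecondCountableTopology E] {μ : Measure E} [μ.HasTemperateGrowth]
    (F : 𝓢(E, ℂ)) : ‖F.toLp 2 μ‖ ^ 2 = ∫ ξ, ‖F ξ‖ ^ 2 ∂μ := by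
  rw [SchwartzMap.norm_toLp' (by norm_num) (by norm_num)]
  simp only [ENNReal.toReal_ofNat, Real.rpow_two]
  rw [← Real.rpow_natCast, ← Real.rpow_mul (integral_nonneg fun _ => by positivity)]
  norm_num

/-- The norm of `f_D`, by Plancherel and the disjointness of its frequency packets. -/
lemma norm_sq_toLp_fD {n : ℕ} [NeZero n] (hψ : ∀ η, 1 ≤ |η| → profile φ η = 0) {R D : ℝ}
    (hR : 1 ≤ R) (hD : 2 ≤ D) (h : MemLp (fD (n := n) φ R D) 2) :
    ‖(h.toLp : L2 n)‖ ^ 2 = (Real.sqrt R)⁻¹ * (freqs R D).card ^ (n - 1) *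
      (∫ η, ‖profile φ η‖ ^ 2) ^ n := by
  have hD0 : 0 < D := by linarith
  rw [← Lp.norm_fourier_eq, fourier_toLp_fD hψ hR hD0, norm_sq_toLp_two]
  simp only [fDHat_apply, norm_prod, ← Finset.prod_pow]
  rw [← (PiLp.volume_preserving_toLp (Fin n)).integral_comp
    (MeasurableEquiv.toLp 2 (Fin n → ℝ)).measurableEmbedding]
  rw [integral_fintype_prod_volume_eq_prod (fun j η => ‖factorHat (profile φ) R D j η‖ ^ 2),
    ← Finset.mul_prod_erase _ _ (Finset.mem_univ (0 : Fin n))]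
  have h1 : ∀ j ∈ Finset.univ.erase (0 : Fin n),
      ∫ η, ‖factorHat (profile φ) R D j η‖ ^ 2 =
        (freqs R D).card * ∫ η, ‖profile φ η‖ ^ 2 := by
    intro j hj
    simp only [factorHat, if_neg (Finset.ne_of_mem_erase hj)]
    exact integral_norm_sq_otherHat hψ R hD
  rw [Finset.prod_congr rfl h1, Finset.prod_const, Finset.card_erase_of_mem (Finset.mem_univ _),
    Finset.card_univ, Fintype.card_fin]
  simp only [factorHat, if_true]
  rw [integral_norm_sq_firstHat _ (by linarith), mul_pow]
  have h2 : (∫ η, ‖profile φ η‖ ^ 2) ^ n =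
      (∫ η, ‖profile φ η‖ ^ 2) * (∫ η, ‖profile φ η‖ ^ 2) ^ (n - 1) := by
    rw [← pow_succ', Nat.sub_add_cancel (Nat.one_le_iff_ne_zero.2 (NeZero.ne n))]
  rw [h2]
  ring

lemma integral_norm_sq_profile_pos (hφ : φ 0 = 1) : 0 < ∫ η, ‖profile φ η‖ ^ 2 := by
  have hi : Integrable (fun η => ‖profile φ η‖ ^ 2) :=
    (memLp_two_iff_integrable_sq_norm (profile φ).continuous.aestronglyMeasurable).1
      ((profile φ).memLp 2)
  have hc : Continuous (fun η => ‖profile φ η‖ ^ 2) := (profile φ).continuous.norm.pow 2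
  obtain ⟨η, hη⟩ : ∃ η, profile φ η ≠ 0 := by
    by_contra! h
    have := packet_profile_zero φ 0
    simp [packet, h, hφ] at this
  rw [integral_pos_iff_support_of_nonneg (fun _ => by positivity) hi]
  exact hc.isOpen_support.measure_pos _ ⟨η, by simpa using hη⟩

end Datum

/-! ### Arithmetic of the parameters -/

lemma one_le_R (k : ℕ) : 1 ≤ R k := one_le_pow₀ (by norm_num)

/-- The gain exponent, with `R_k / (D_k Q_k) = R_k ^ κ` and `s = 1/4 + (n-1) κ / 2`. -/
def gain (n : ℕ) (a b : ℝ) : ℝ := ((n : ℝ) - ((n : ℝ) - 1) * a - b) / ((n : ℝ) + 1)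

section Params

variable {n : ℕ} {a b : ℝ}

lemma gain_pos (hn : 2 ≤ n) (hab : AdmissibleParams a b) : 0 < gain n a b := by
  obtain ⟨h1, h2, h3, h4, h5⟩ := hab
  have hn' : (2 : ℝ) ≤ n := by exact_mod_cast hn
  unfold gain
  apply div_pos _ (by linarith)
  nlinarith

lemma sExp_eq : sExp n a b = 1 / 4 + ((n : ℝ) - 1) * gain n a b / 2 := by
  have : (n : ℝ) + 1 ≠ 0 := by positivity
  unfold sExp gain
  field_simp

lemma sExp_pos (hn : 2 ≤ n) (hab : AdmissibleParams a b) : 0 < sExp n a b := by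
  have hn' : (2 : ℝ) ≤ n := by exact_mod_cast hn
  rw [sExp_eq]
  have := mul_pos (by linarith : 0 < (n : ℝ) - 1) (gain_pos hn hab)
  linarith

lemma R_rpow_gain_mul (k : ℕ) : R k ^ gain n a b * (D n a b k * Q n a b k) = R k := by
  have : (n : ℝ) + 1 ≠ 0 := by positivity
  unfold D Q
  rw [← Real.rpow_add (R_pos k), ← Real.rpow_add (R_pos k)]
  convert Real.rpow_one (R k) using 2
  unfold gain
  field_simp
  ring

lemma D_pos (k : ℕ) : 0 < D n a b k := Real.rpow_pos_of_pos (R_pos k) _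

lemma one_le_Q (hn : 2 ≤ n) (hab : AdmissibleParams a b) (k : ℕ) : 1 ≤ Q n a b k := by
  obtain ⟨h1, h2, h3, h4, h5⟩ := hab
  have hn' : (2 : ℝ) ≤ n := by exact_mod_cast hn
  refine Real.one_le_rpow (one_le_R k) (mul_nonneg (div_nonneg ?_ ?_) ?_) <;> linarith

lemma tendsto_R_rpow {σ : ℝ} (hσ : 0 < σ) : Tendsto (fun k => R k ^ σ) atTop atTop :=
  (tendsto_rpow_atTop hσ).comp (tendsto_pow_atTop_atTop_of_one_lt (by norm_num))

lemma tendsto_D (hn : 2 ≤ n) (hab : AdmissibleParams a b) :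
    Tendsto (fun k => D n a b k) atTop atTop := by
  obtain ⟨h1, h2, h3, h4, h5⟩ := hab
  have hn' : (2 : ℝ) ≤ n := by exact_mod_cast hn
  refine tendsto_R_rpow (div_pos ?_ (by linarith))
  nlinarith

/-- The scales at which the frequency packets are disjoint and numerous. -/
def GoodScale (n : ℕ) (a b : ℝ) (k : ℕ) : Prop := 2 ≤ D n a b k ∧ 4 * D n a b k ≤ R k

lemma eventually_goodScale (hn : 2 ≤ n) (hab : AdmissibleParams a b) :
    ∀ᶠ k in atTop, GoodScale n a b k := by
  filter_upwards [(tendsto_D hn hab).eventually_ge_atTop 2,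
    (tendsto_R_rpow (gain_pos hn hab)).eventually_ge_atTop 4] with k h1 h2
  refine ⟨h1, ?_⟩
  rw [← R_rpow_gain_mul (n := n) (a := a) (b := b) k]
  have h3 := one_le_Q hn hab k
  have h4 : 4 * (D n a b k * 1) ≤ R k ^ gain n a b * (D n a b k * Q n a b k) := by
    gcongr
  linarith

lemma card_freqs_bounds {R D : ℝ} (hD : 1 ≤ D) (hR : 4 * D ≤ R) :
    R / (4 * D) ≤ (freqs R D).card ∧ ((freqs R D).card : ℝ) ≤ R / (2 * D) + 1 ∧
      ((freqs R D).card : ℝ) ≤ R := by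
  have hD0 : 0 < D := by linarith
  have h4 : 4 ≤ R / D := by rw [le_div_iff₀ hD0]; exact hR
  have e2 : R / (2 * D) = R / D / 2 := by rw [div_div, mul_comm]
  have e4 : R / (4 * D) = R / D / 4 := by rw [div_div, mul_comm]
  have e1 : R / D ≤ R := div_le_self (by linarith) hD
  have f1 := Int.floor_le (R / (2 * D))
  have f2 := Int.lt_floor_add_one (R / (2 * D))
  have c1 := Int.le_ceil (R / D)
  have c2 := Int.ceil_lt_add_one (R / D)
  have hnn : 0 ≤ ⌈R / D⌉ - ⌊R / (2 * D)⌋ - 1 := by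
    have : (0 : ℝ) ≤ ((⌈R / D⌉ - ⌊R / (2 * D)⌋ - 1 : ℤ) : ℝ) := by
      push_cast
      linarith
    exact_mod_cast this
  have hcard : ((freqs R D).card : ℝ) = ⌈R / D⌉ - ⌊R / (2 * D)⌋ - 1 := by
    unfold freqs
    rw [Int.card_Ioo]
    have := Int.toNat_of_nonneg hnn
    rw [← Int.cast_natCast, this]
    push_cast
    ring
  rw [hcard, e4]
  refine ⟨?_, ?_, ?_⟩ <;> linarith

lemma summable_mul_R_rpow_neg {σ : ℝ} (hσ : 0 < σ) :
    Summable fun k : ℕ => (k : ℝ) * R k ^ (-σ) := by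
  have h1 : ‖(2 : ℝ) ^ (-σ)‖ < 1 := by
    rw [Real.norm_of_nonneg (by positivity)]
    exact Real.rpow_lt_one_of_one_lt_of_neg (by norm_num) (by linarith)
  have := summable_pow_mul_geometric_of_norm_lt_one 1 h1
  refine this.congr fun k => ?_
  rw [pow_one, R, ← Real.rpow_natCast, ← Real.rpow_natCast, ← Real.rpow_mul (by norm_num),
    ← Real.rpow_mul (by norm_num), mul_comm (-σ)]

end Params

/-! ### The coefficients of the series -/

/-- The coefficient of `f_{D_k}` in the initial datum. -/
def coeff (n : ℕ) [NeZero n] (φ : 𝓢(ℝ, ℝ)) (a b : ℝ) (k : ℕ) : ℝ :=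
  R k ^ (-sExp n a b) * ((k : ℝ) / ‖fDk n φ a b k‖)

section Coeff

variable {n : ℕ} [NeZero n] {φ : 𝓢(ℝ, ℝ)} {a b : ℝ}

lemma coeff_nonneg (k : ℕ) : 0 ≤ coeff n φ a b k := by
  have := R_pos k
  unfold coeff; positivity

lemma fDk_ne_zero (hψ : ∀ η, 1 ≤ |η| → profile φ η = 0) (hφ : φ 0 = 1) {k : ℕ}
    (hk : GoodScale n a b k) : fDk n φ a b k ≠ 0 := by
  have h1 := norm_sq_toLp_fD hψ (one_le_R k) hk.1 (memLp_fD (n := n) φ (R_pos k) (D n a b k))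
  have h2 := integral_norm_sq_profile_pos hφ
  have h3 := R_pos k
  have h4 := (card_freqs_bounds (by linarith [hk.1] : 1 ≤ D n a b k) hk.2).1
  have h5 : 0 < ((freqs (R k) (D n a b k)).card : ℝ) :=
    lt_of_lt_of_le (by have := D_pos (n := n) (a := a) (b := b) k; positivity) h4
  intro h0
  unfold fDk at h0
  rw [h0, norm_zero] at h1
  have : 0 < (Real.sqrt (R k))⁻¹ * ((freqs (R k) (D n a b k)).card : ℝ) ^ (n - 1) *
    (∫ η, ‖profile φ η‖ ^ 2) ^ n := by
    have := Real.sqrt_pos.2 h3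
    positivity
  rw [← h1] at this
  norm_num at this

lemma norm_gTerm (hψ : ∀ η, 1 ≤ |η| → profile φ η = 0) (hφ : φ 0 = 1) {k : ℕ}
    (hk : GoodScale n a b k) : ‖gTerm n φ a b k‖ = k * R k ^ (-sExp n a b) := by
  have h1 : ‖fDk n φ a b k‖ ≠ 0 := norm_ne_zero_iff.2 (fDk_ne_zero hψ hφ hk)
  change ‖((coeff n φ a b k : ℝ) : ℂ) • fDk n φ a b k‖ = _
  rw [norm_smul, Complex.norm_real, Real.norm_of_nonneg (coeff_nonneg k), coeff]
  field_simp

/-- The normalisation of the series in closed form. -/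
lemma coeff_sq_mul (hn : 2 ≤ n) (hψ : ∀ η, 1 ≤ |η| → profile φ η = 0) (hφ : φ 0 = 1) {k : ℕ}
    (hk : GoodScale n a b k) :
    coeff n φ a b k ^ 2 * ((freqs (R k) (D n a b k)).card * R k ^ gain n a b) ^ (n - 1) *
      (∫ η, ‖profile φ η‖ ^ 2) ^ n = k ^ 2 := by
  have h1 := norm_sq_toLp_fD hψ (one_le_R k) hk.1 (memLp_fD (n := n) φ (R_pos k) (D n a b k))
  have h2 : ‖fDk n φ a b k‖ ≠ 0 := norm_ne_zero_iff.2 (fDk_ne_zero hψ hφ hk)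
  have h3 := R_pos k
  have hR : (R k ^ (-sExp n a b)) ^ 2 * (R k ^ gain n a b) ^ (n - 1) = (Real.sqrt (R k))⁻¹ := by
    rw [← Real.rpow_natCast, ← Real.rpow_natCast, ← Real.rpow_mul h3.le, ← Real.rpow_mul h3.le,
      ← Real.rpow_add h3, Real.sqrt_eq_rpow, ← Real.rpow_neg h3.le, sExp_eq,
      Nat.cast_sub (by omega)]
    congr 1
    push_cast
    ring
  change ‖fDk n φ a b k‖ ^ 2 = _ at h1
  unfold coeff
  rw [mul_pow, mul_pow, div_pow]
  calc _ = (R k ^ (-sExp n a b)) ^ 2 * (R k ^ gain n a b) ^ (n - 1) *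
        (((freqs (R k) (D n a b k)).card : ℝ) ^ (n - 1) * (∫ η, ‖profile φ η‖ ^ 2) ^ n) *
        (k ^ 2 / ‖fDk n φ a b k‖ ^ 2) := by ring
    _ = ‖fDk n φ a b k‖ ^ 2 * (k ^ 2 / ‖fDk n φ a b k‖ ^ 2) := by rw [hR, h1]; ring
    _ = k ^ 2 := by field_simp

/-- Since `s ≥ 1/4`, the normalising coefficients grow at most linearly. -/
lemma exists_coeff_le (hn : 2 ≤ n) (hab : AdmissibleParams a b)
    (hψ : ∀ η, 1 ≤ |η| → profile φ η = 0) (hφ : φ 0 = 1) :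
    ∃ C : ℝ, 0 ≤ C ∧ ∀ k, GoodScale n a b k → coeff n φ a b k ≤ C * k := by
  set I := ∫ η, ‖profile φ η‖ ^ 2 with hI
  have hI0 : 0 < I := integral_norm_sq_profile_pos hφ
  refine ⟨(Real.sqrt (I ^ n))⁻¹, by positivity, fun k hk => ?_⟩
  have h1 := coeff_sq_mul hn hψ hφ hk
  rw [← hI] at h1
  have hs : 0 < Real.sqrt (I ^ n) := by positivity
  have h5 := card_freqs_bounds (by linarith [hk.1] : 1 ≤ D n a b k) hk.2
  have hM : (1 : ℝ) ≤ (freqs (R k) (D n a b k)).card := by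
    refine le_trans ?_ h5.1
    rw [le_div_iff₀ (by linarith [D_pos (n := n) (a := a) (b := b) k])]
    linarith [hk.2]
  have hκ : 1 ≤ R k ^ gain n a b := Real.one_le_rpow (one_le_R k) (gain_pos hn hab).le
  have h6 : (1 : ℝ) ≤ ((freqs (R k) (D n a b k)).card * R k ^ gain n a b) ^ (n - 1) :=
    one_le_pow₀ (one_le_mul_of_one_le_of_one_le hM hκ)
  rw [inv_mul_eq_div, le_div_iff₀ hs]
  refine abs_le_of_sq_le_sq' ?_ (by positivity) |>.2
  rw [mul_pow, Real.sq_sqrt (by positivity), ← h1]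
  have h7 : 0 ≤ coeff n φ a b k ^ 2 := by positivity
  calc coeff n φ a b k ^ 2 * I ^ n = coeff n φ a b k ^ 2 * 1 * I ^ n := by ring
    _ ≤ _ := by gcongr

/-- The gain of the exponent `s`: the amplitude `(M / √q) ^ (n - 1)` of the evolved datum on a slab
of denominator `q ≤ Q_k` compensates the normalisation. -/
lemma exists_mul_le_coeff_mul (hn : 2 ≤ n) (hψ : ∀ η, 1 ≤ |η| → profile φ η = 0) (hφ : φ 0 = 1) :
    ∃ c : ℝ, 0 < c ∧ ∀ k, GoodScale n a b k → ∀ q : ℝ, 0 < q → q ≤ Q n a b k →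
      c * k ≤ coeff n φ a b k *
        ((freqs (R k) (D n a b k)).card / (4 * Real.sqrt q)) ^ (n - 1) := by
  set I := ∫ η, ‖profile φ η‖ ^ 2 with hI
  have hI0 : 0 < I := integral_norm_sq_profile_pos hφ
  refine ⟨(Real.sqrt (64 ^ (n - 1) * I ^ n))⁻¹, by positivity, fun k hk q hq hqQ => ?_⟩
  have h1 := coeff_sq_mul hn hψ hφ hk
  rw [← hI] at h1
  have hs : 0 < Real.sqrt (64 ^ (n - 1) * I ^ n) := by positivity
  have h5 := (card_freqs_bounds (by linarith [hk.1] : 1 ≤ D n a b k) hk.2).1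
  set M : ℝ := ((freqs (R k) (D n a b k)).card : ℝ) with hM
  have hM0 : 0 ≤ M := by positivity
  have hD := D_pos (n := n) (a := a) (b := b) k
  have hκ : R k ^ gain n a b ≤ 4 * M / q := by
    rw [le_div_iff₀ hq]
    rw [div_le_iff₀ (by positivity)] at h5
    have h6 := R_rpow_gain_mul (n := n) (a := a) (b := b) k
    have h7 : 0 < R k ^ gain n a b := Real.rpow_pos_of_pos (R_pos k) _
    have h8 : R k ^ gain n a b * q * D n a b k ≤ 4 * M * D n a b k := by
      calc R k ^ gain n a b * q * D n a b k ≤ R k ^ gain n a b * Q n a b k * D n a b k := by gcongr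
        _ = R k ^ gain n a b * (D n a b k * Q n a b k) := by ring
        _ ≤ _ := by rw [h6]; linarith
    exact le_of_mul_le_mul_right h8 hD
  have hR0 : 0 < R k ^ gain n a b := Real.rpow_pos_of_pos (R_pos k) _
  rw [inv_mul_eq_div, div_le_iff₀ hs]
  refine abs_le_of_sq_le_sq' ?_ (by have := coeff_nonneg (n := n) (φ := φ) (a := a) (b := b) k
                                    positivity) |>.2
  rw [mul_pow, Real.sq_sqrt (by positivity), ← h1, mul_pow (coeff n φ a b k)]
  have h7 : ((M / (4 * Real.sqrt q)) ^ (n - 1)) ^ 2 * 64 ^ (n - 1) =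
      (M * (4 * M / q)) ^ (n - 1) := by
    rw [← pow_mul, mul_comm (n - 1) 2, pow_mul, ← mul_pow]
    congr 1
    rw [div_pow, mul_pow, Real.sq_sqrt hq.le]
    field_simp
    norm_num
  calc coeff n φ a b k ^ 2 * (M * R k ^ gain n a b) ^ (n - 1) * I ^ n
      ≤ coeff n φ a b k ^ 2 * (M * (4 * M / q)) ^ (n - 1) * I ^ n := by gcongr
    _ = _ := by rw [← h7]; ring

lemma summable_norm_gTerm (hn : 2 ≤ n) (hab : AdmissibleParams a b)
    (hψ : ∀ η, 1 ≤ |η| → profile φ η = 0) (hφ : φ 0 = 1) {k₀ : ℕ}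
    (hk₀ : ∀ k, k₀ ≤ k → GoodScale n a b k) :
    Summable fun m => ‖gTerm n φ a b (k₀ + m)‖ := by
  have h1 := (summable_nat_add_iff k₀).2 (summable_mul_R_rpow_neg (sExp_pos hn hab))
  refine h1.congr fun m => ?_
  rw [norm_gTerm hψ hφ (hk₀ _ (by omega)), add_comm m k₀]

end Coeff

/-! ### Sobolev regularity -/

open TemperedDistribution in
/-- The Bessel potential of a band-limited Schwartz function. -/
lemma exists_besselPotential_eq_of_bandLimited {n : ℕ}
    {f : 𝓢(EuclideanSpace ℝ (Fin n), ℂ)} {B s : ℝ}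
    (hs : 0 ≤ s) (hf : ∀ ξ, 𝓕 f ξ ≠ 0 → 1 + ‖ξ‖ ^ 2 ≤ B) :
    ∃ v : L2 n, besselPotential (EuclideanSpace ℝ (Fin n)) ℂ s
      ((f.toLp 2 : L2 n) : 𝓢'(EuclideanSpace ℝ (Fin n), ℂ)) = v ∧
        ‖v‖ ≤ B ^ (s / 2) * ‖(f.toLp 2 : L2 n)‖ := by
  set w : EuclideanSpace ℝ (Fin n) → ℂ := fun x => (((1 + ‖x‖ ^ 2) ^ (s / 2) : ℝ) : ℂ) with hw
  have hwt : w.HasTemperateGrowth := by fun_prop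
  refine ⟨(SchwartzMap.fourierMultiplierCLM ℂ w f).toLp 2, ?_, ?_⟩
  · rw [besselPotential, Lp.toTemperedDistribution_toLp_eq,
      TemperedDistribution.fourierMultiplierCLM_toTemperedDistributionCLM_eq (by fun_prop),
      Lp.toTemperedDistribution_toLp_eq]
  · rw [← Lp.norm_fourier_eq, ← Lp.norm_fourier_eq (f.toLp 2 volume : L2 n),
      SchwartzMap.toLp_fourier_eq, SchwartzMap.toLp_fourier_eq, SchwartzMap.fourierMultiplierCLM_apply,
      FourierTransform.fourier_fourierInv_eq]
    refine Lp.norm_le_mul_norm_of_ae_le_mul ?_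
    filter_upwards [SchwartzMap.coeFn_toLp (𝓕 f) 2 volume,
      SchwartzMap.coeFn_toLp (SchwartzMap.smulLeftCLM ℂ w (𝓕 f)) 2 volume] with ξ h1 h2
    rw [h1, h2, SchwartzMap.smulLeftCLM_apply_apply hwt, norm_smul]
    by_cases h0 : 𝓕 f ξ = 0
    · simp [h0]
    · gcongr
      rw [hw, Complex.norm_real, Real.norm_of_nonneg (by positivity)]
      gcongr
      exact hf ξ h0

/-- The Bessel potentials of the terms of the series are summable in `L²`. -/
lemma memSobolev_g {n : ℕ} [NeZero n] {φ : 𝓢(ℝ, ℝ)} {a b : ℝ} (hn : 2 ≤ n)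
    (hab : AdmissibleParams a b) (hψ : ∀ η, 1 ≤ |η| → profile φ η = 0) (hφ : φ 0 = 1) {k₀ : ℕ}
    (hk₀ : ∀ k, k₀ ≤ k → GoodScale n a b k) {s' : ℝ} (hs' : s' < sExp n a b) :
    TemperedDistribution.MemSobolev s' 2
      (g n φ a b k₀ : 𝓢'(EuclideanSpace ℝ (Fin n), ℂ)) := by
  have hmax : max s' 0 < sExp n a b := max_lt hs' (sExp_pos hn hab)
  refine TemperedDistribution.MemSobolev.mono (le_max_left s' 0) ?_
  set σ := max s' 0 with hσ
  have hσ0 : 0 ≤ σ := le_max_right _ _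
  have hn0 : (0 : ℝ) < n := by positivity
  have hterm : ∀ m : ℕ, ∃ v : L2 n,
      TemperedDistribution.besselPotential (EuclideanSpace ℝ (Fin n)) ℂ σ
        (gTerm n φ a b (k₀ + m) : 𝓢'(EuclideanSpace ℝ (Fin n), ℂ)) = v ∧
      ‖v‖ ≤ (5 * n) ^ (σ / 2) *
        (((m + k₀ : ℕ) : ℝ) * R (m + k₀) ^ (-(sExp n a b - σ))) := by
    intro m
    rw [add_comm m k₀]
    set k := k₀ + m
    have hk : GoodScale n a b k := hk₀ k (by omega)
    have hD : 0 < D n a b k := D_pos k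
    have hR1 := one_le_R k
    have hR0 := R_pos k
    obtain ⟨v, hv1, hv2⟩ := exists_besselPotential_eq_of_bandLimited (n := n)
      (f := 𝓕⁻ (fDHat (n := n) hψ hR1 hD)) (B := 5 * n * R k ^ 2) hσ0 (by
        intro ξ hξ
        rw [FourierTransform.fourier_fourierInv_eq, fDHat_apply] at hξ
        have hc : ξ ∈ cube n (4 * R k) := by
          by_contra hc
          exact hξ (prod_factorHat_eq_zero hψ hR1 hD le_rfl hc)
        have h2 : ‖ξ‖ ^ 2 ≤ n * (2 * R k) ^ 2 := by
          rw [EuclideanSpace.norm_sq_eq]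
          refine (Finset.sum_le_card_nsmul _ _ ((2 * R k) ^ 2) fun j _ => ?_).trans (by simp)
          have := hc j
          rw [Real.norm_eq_abs]
          gcongr
          linarith
        have h3 : (1 : ℝ) ≤ n := by exact_mod_cast (by omega : 1 ≤ n)
        have h4 : 1 ≤ n * R k ^ 2 := one_le_mul_of_one_le_of_one_le h3 (one_le_pow₀ hR1)
        nlinarith)
    have hf : (fDk n φ a b k : L2 n) = (𝓕⁻ (fDHat (n := n) hψ hR1 hD)).toLp 2 :=
      toLp_fD_eq hψ hR1 hD _
    rw [← hf] at hv1 hv2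
    refine ⟨((coeff n φ a b k : ℝ) : ℂ) • v, ?_, ?_⟩
    · change TemperedDistribution.besselPotential (EuclideanSpace ℝ (Fin n)) ℂ σ
        ((((coeff n φ a b k : ℝ) : ℂ) • fDk n φ a b k : L2 n) :
          𝓢'(EuclideanSpace ℝ (Fin n), ℂ)) = _
      rw [← Lp.toTemperedDistributionCLM_apply, ← Lp.toTemperedDistributionCLM_apply, map_smul,
        map_smul, map_smul, Lp.toTemperedDistributionCLM_apply, hv1,
        Lp.toTemperedDistributionCLM_apply]
    · have h5 : ‖((coeff n φ a b k : ℝ) : ℂ)‖ * ‖fDk n φ a b k‖ = k * R k ^ (-sExp n a b) := by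
        rw [← norm_gTerm hψ hφ hk, ← norm_smul]; rfl
      rw [norm_smul]
      calc _ ≤ ‖((coeff n φ a b k : ℝ) : ℂ)‖ * ((5 * n * R k ^ 2) ^ (σ / 2) * ‖fDk n φ a b k‖) := by
            gcongr
        _ = (5 * n * R k ^ 2) ^ (σ / 2) * (k * R k ^ (-sExp n a b)) := by rw [← h5]; ring
        _ = _ := by
            rw [Real.mul_rpow (by positivity) (by positivity), ← Real.rpow_natCast,
              ← Real.rpow_mul hR0.le, neg_sub, sub_eq_add_neg, Real.rpow_add hR0]
            rw [show ((2 : ℕ) : ℝ) * (σ / 2) = σ by push_cast; ring]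
            ring
  choose v hv1 hv2 using hterm
  have hsv : Summable v := by
    refine Summable.of_norm_bounded (Summable.mul_left _ ((summable_nat_add_iff k₀).2
      (summable_mul_R_rpow_neg (by linarith : 0 < sExp n a b - σ)))) hv2
  refine ⟨∑' m, v m, ?_⟩
  have hsg : Summable fun m => gTerm n φ a b (k₀ + m) :=
    (summable_norm_gTerm hn hab hψ hφ hk₀).of_norm
  have h1 : HasSum (fun m => TemperedDistribution.besselPotential (EuclideanSpace ℝ (Fin n)) ℂ σ
      (gTerm n φ a b (k₀ + m) : 𝓢'(EuclideanSpace ℝ (Fin n), ℂ)))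
      (TemperedDistribution.besselPotential (EuclideanSpace ℝ (Fin n)) ℂ σ
        (g n φ a b k₀ : 𝓢'(EuclideanSpace ℝ (Fin n), ℂ))) :=
    hsg.hasSum.mapL
      (TemperedDistribution.besselPotential (EuclideanSpace ℝ (Fin n)) ℂ σ ∘L
        Lp.toTemperedDistributionCLM ℂ volume 2)
  have h2 : HasSum (fun m => ((v m : L2 n) : 𝓢'(EuclideanSpace ℝ (Fin n), ℂ)))
      ((∑' m, v m : L2 n) : 𝓢'(EuclideanSpace ℝ (Fin n), ℂ)) :=
    hsv.hasSum.mapL (Lp.toTemperedDistributionCLM ℂ volume 2)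
  simp_rw [hv1] at h1
  exact h1.unique h2

/-! ### Existence of the pointwise limit -/

/-- The truncated flow at a point is a bounded linear functional on `L²`. -/
lemma exists_truncatedFlow_eq_clm {n : ℕ} (N t : ℝ) (x : EuclideanSpace ℝ (Fin n)) :
    ∃ Λ : L2 n →L[ℂ] ℂ, ∀ f : L2 n, Λ f = truncatedFlow f N t x := by
  set E : EuclideanSpace ℝ (Fin n) → ℂ := fun ξ =>
    (starRingEnd ℂ) (e (-Real.pi * t * ‖ξ‖ ^ 2 + 2 * Real.pi * inner ℝ x ξ)) with hE
  have hm : MeasurableSet (cube n N) := (isCompact_cube n N).measurableSet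
  have hEc : Continuous E := by
    have := continuous_e
    fun_prop
  have hmem : MemLp ((cube n N).indicator E) 2 := by
    rw [memLp_indicator_iff_restrict hm]
    have : IsFiniteMeasure (volume.restrict (cube n N)) :=
      ⟨by rw [Measure.restrict_apply_univ]; exact (isCompact_cube n N).measure_lt_top⟩
    refine MemLp.of_bound hEc.aestronglyMeasurable 1 (Eventually.of_forall fun ξ => ?_)
    simp only [hE]
    rw [RCLike.norm_conj, norm_e]
  refine ⟨innerSL ℂ (hmem.toLp : L2 n) ∘L
    (Lp.fourierTransformₗᵢ (EuclideanSpace ℝ (Fin n)) ℂ).toContinuousLinearEquiv, fun f => ?_⟩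
  change inner ℂ (hmem.toLp : L2 n) (𝓕 f : L2 n) = _
  rw [L2.inner_def, truncatedFlow, ← integral_indicator hm]
  refine integral_congr_ae ?_
  filter_upwards [hmem.coeFn_toLp] with ξ hξ
  rw [hξ]
  by_cases h : ξ ∈ cube n N
  · simp [h, hE]
  · simp [h]

/-- The full evolution of `f_{D_k}`. -/
def evolved (n : ℕ) [NeZero n] (φ : 𝓢(ℝ, ℝ)) (a b : ℝ) (k : ℕ) (t : ℝ)
    (x : EuclideanSpace ℝ (Fin n)) : ℂ :=
  (e (-Real.pi * t * R k ^ 2 + 2 * Real.pi * x 0 * R k) *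
    packet (profile φ) (t * R k) (Real.sqrt (R k) * (x 0 - t * R k))) *
  ∏ j ∈ Finset.univ.erase (0 : Fin n), ∑ l ∈ freqs (R k) (D n a b k),
    e (-Real.pi * t * (D n a b k * l) ^ 2 + 2 * Real.pi * x j * (D n a b k * l)) *
      packet (profile φ) t (x j - t * (D n a b k * l))

section Flow

variable {n : ℕ} [NeZero n] {φ : 𝓢(ℝ, ℝ)} {a b : ℝ}

lemma truncatedFlow_fDk_eq_evolved (hψ : ∀ η, 1 ≤ |η| → profile φ η = 0) (k : ℕ) {N : ℝ}
    (hN : 4 * R k ≤ N) (t : ℝ) (x : EuclideanSpace ℝ (Fin n)) :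
    truncatedFlow (fDk n φ a b k) N t x = evolved n φ a b k t x := by
  have hR1 := one_le_R k
  unfold fDk evolved
  rw [truncatedFlow_toLp_fD hψ hR1 (D_pos k) _ (by linarith),
    ← Finset.mul_prod_erase _ _ (Finset.mem_univ (0 : Fin n))]
  congr 1
  · simp only [factorHat, if_true]
    exact cutFlow_firstHat_eq hψ hR1 hN _ _
  · refine Finset.prod_congr rfl fun j hj => ?_
    simp only [factorHat, if_neg (Finset.ne_of_mem_erase hj)]
    exact cutFlow_otherHat_eq hψ hR1 (D_pos k) hN _ _

/-- At a fixed positive time the evolved pieces of high frequency are small at any given point,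
uniformly over sharp frequency cut-offs: one integration by parts in the first variable gains
`R_k ^ (-1/2)`, and one in each other variable makes up for the number of frequencies. -/
lemma exists_norm_truncatedFlow_fDk_le (hψ : ∀ η, 1 ≤ |η| → profile φ η = 0) {t : ℝ} (ht : 0 < t)
    (x : EuclideanSpace ℝ (Fin n)) :
    ∃ C : ℝ, 0 ≤ C ∧ ∀ k, GoodScale n a b k → ∀ N : ℝ, 0 ≤ N →
      ‖truncatedFlow (fDk n φ a b k) N t x‖ ≤ C * R k ^ (-(1 / 2) : ℝ) := by
  obtain ⟨C₀, hC₀, h0⟩ := exists_norm_cutPacket_le_div_sqrt (profile φ) ht (x 0)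
  choose C hC hCb using fun j : Fin n => exists_norm_cutPacket_le_div (profile φ) ht (x j)
  refine ⟨C₀ * ∏ j ∈ Finset.univ.erase (0 : Fin n), C j,
    mul_nonneg hC₀ (Finset.prod_nonneg fun j _ => hC j), fun k hk N hN => ?_⟩
  have hR1 := one_le_R k
  have hR0 := R_pos k
  have hD := D_pos (n := n) (a := a) (b := b) k
  have hs0 := Real.sqrt_pos.2 hR0
  unfold fDk
  rw [truncatedFlow_toLp_fD hψ hR1 (D_pos k) _ hN,
    ← Finset.mul_prod_erase _ _ (Finset.mem_univ (0 : Fin n)), norm_mul, norm_prod,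
    Real.rpow_neg hR0.le, ← Real.sqrt_eq_rpow, mul_right_comm]
  refine mul_le_mul ?_ (Finset.prod_le_prod (fun _ _ => norm_nonneg _) fun j hj => ?_)
    (Finset.prod_nonneg fun _ _ => norm_nonneg _) (by positivity)
  · simp only [factorHat, if_true]
    rw [cutFlow_firstHat _ hR0, norm_mul, norm_e, one_mul, ← div_eq_mul_inv]
    refine h0 _ _ _ ?_ hR1
    gcongr
    linarith
  · simp only [factorHat, if_neg (Finset.ne_of_mem_erase hj)]
    rw [cutFlow_otherHat]
    have hM := (card_freqs_bounds (by linarith [hk.1] : 1 ≤ D n a b k) hk.2).2.2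
    refine (norm_sum_le _ _).trans ((Finset.sum_le_card_nsmul _ _ (C j / R k)
      fun l hl => ?_).trans ?_)
    · rw [norm_mul, norm_e, one_mul]
      refine hCb j _ _ _ _ (by linarith) hR0 (mul_lt_of_mem_freqs hD hl).1.le
    · rw [nsmul_eq_mul, mul_div_assoc', div_le_iff₀ hR0, mul_comm (C j)]
      gcongr
      exact hC j

/-- The pointwise limit defining the solution exists at every point and every positive time, and the
solution is the sum of the evolved pieces. -/
lemma hasSum_flow_g (hn : 2 ≤ n) (hab : AdmissibleParams a b)
    (hψ : ∀ η, 1 ≤ |η| → profile φ η = 0) (hφ : φ 0 = 1) {k₀ : ℕ}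
    (hk₀ : ∀ k, k₀ ≤ k → GoodScale n a b k) {t : ℝ} (ht : 0 < t)
    (x : EuclideanSpace ℝ (Fin n)) :
    FlowDefinedAt (g n φ a b k₀) t x ∧
      HasSum (fun m => (coeff n φ a b (k₀ + m) : ℂ) * evolved n φ a b (k₀ + m) t x)
        (flow (g n φ a b k₀) t x) := by
  obtain ⟨C, hC0, hC⟩ := exists_norm_truncatedFlow_fDk_le (a := a) (b := b) hψ ht x
  obtain ⟨B, hB0, hB⟩ := exists_coeff_le (φ := φ) hn hab hψ hφ
  have hsg : Summable fun m => gTerm n φ a b (k₀ + m) :=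
    (summable_norm_gTerm hn hab hψ hφ hk₀).of_norm
  have hterm : ∀ N m, truncatedFlow (gTerm n φ a b (k₀ + m)) N t x =
      (coeff n φ a b (k₀ + m) : ℂ) * truncatedFlow (fDk n φ a b (k₀ + m)) N t x := by
    intro N m
    obtain ⟨Λ, hΛ⟩ := exists_truncatedFlow_eq_clm N t x
    rw [← hΛ, ← hΛ, ← smul_eq_mul, ← map_smul]
    rfl
  have hsum : ∀ N, truncatedFlow (g n φ a b k₀) N t x =
      ∑' m, truncatedFlow (gTerm n φ a b (k₀ + m)) N t x := by
    intro N
    obtain ⟨Λ, hΛ⟩ := exists_truncatedFlow_eq_clm N t x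
    simp_rw [← hΛ]
    exact Λ.map_tsum hsg
  set bound : ℕ → ℝ := fun m => B * C * (((m + k₀ : ℕ) : ℝ) * R (m + k₀) ^ (-(1 / 2) : ℝ))
    with hbound
  have hbs : Summable bound := Summable.mul_left _ ((summable_nat_add_iff k₀).2
      (summable_mul_R_rpow_neg (by norm_num : (0 : ℝ) < 1 / 2)))
  have hb : ∀ N, 0 ≤ N → ∀ m, ‖truncatedFlow (gTerm n φ a b (k₀ + m)) N t x‖ ≤ bound m := by
    intro N hN m
    have hk := hk₀ (k₀ + m) (by omega)
    rw [hterm, norm_mul, Complex.norm_real, Real.norm_of_nonneg (coeff_nonneg _), hbound]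
    simp only
    rw [add_comm m k₀]
    have hR := R_pos (k₀ + m)
    calc _ ≤ (B * ((k₀ + m : ℕ) : ℝ)) * (C * R (k₀ + m) ^ (-(1 / 2) : ℝ)) :=
          mul_le_mul (hB _ hk) (hC _ hk N hN) (norm_nonneg _) (by positivity)
      _ = _ := by ring
  have hlim : ∀ m, ∀ᶠ N : ℝ in atTop, truncatedFlow (gTerm n φ a b (k₀ + m)) N t x =
      (coeff n φ a b (k₀ + m) : ℂ) * evolved n φ a b (k₀ + m) t x := by
    intro m
    filter_upwards [eventually_ge_atTop (4 * R (k₀ + m))] with N hN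
    rw [hterm, truncatedFlow_fDk_eq_evolved hψ _ hN]
  have htend : Tendsto (fun N : ℝ => truncatedFlow (g n φ a b k₀) N t x) atTop
      (𝓝 (∑' m, (coeff n φ a b (k₀ + m) : ℂ) * evolved n φ a b (k₀ + m) t x)) := by
    simp_rw [hsum]
    refine tendsto_tsum_of_dominated_convergence hbs
      (fun m => tendsto_const_nhds.congr' ((hlim m).mono fun N hN => hN.symm)) ?_
    filter_upwards [eventually_ge_atTop 0] with N hN m
    exact hb N hN m
  refine ⟨⟨_, htend⟩, ?_⟩
  have hfl : flow (g n φ a b k₀) t x =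
      ∑' m, (coeff n φ a b (k₀ + m) : ℂ) * evolved n φ a b (k₀ + m) t x := htend.limUnder_eq
  rw [hfl]
  refine Summable.hasSum (Summable.of_norm_bounded hbs fun m => ?_)
  obtain ⟨N, hN, hN0⟩ := ((hlim m).and (eventually_ge_atTop 0)).exists
  rw [← hN]
  exact hb N hN0 m

end Flow

/-! ### The main term on a slab -/

/-- The frequencies are consecutive integers. -/
lemma sum_freqs_eq_sum_range {R D : ℝ} (h : 0 < (freqs R D).card) (f : ℤ → ℂ) :
    ∑ l ∈ freqs R D, f l =
      ∑ i ∈ Finset.range (freqs R D).card, f ((⌊R / (2 * D)⌋ + 1) + i) := by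
  have hc : (freqs R D).card = (⌈R / D⌉ - ⌊R / (2 * D)⌋ - 1).toNat := by
    unfold freqs; rw [Int.card_Ioo]
  symm
  refine Finset.sum_nbij' (fun i : ℕ => (⌊R / (2 * D)⌋ + 1) + i)
    (fun l => (l - (⌊R / (2 * D)⌋ + 1)).toNat) ?_ ?_ ?_ ?_ ?_
  · intro i hi
    rw [Finset.mem_range] at hi
    unfold freqs
    rw [Finset.mem_Ioo]
    omega
  · intro l hl
    unfold freqs at hl
    rw [Finset.mem_Ioo] at hl
    rw [Finset.mem_range]
    omega
  · intro i _
    simp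
  · intro l hl
    unfold freqs at hl
    rw [Finset.mem_Ioo] at hl
    omega
  · intro i _
    rfl

/-- The evolved first factor is of size one along the line `x₁ = t R`. -/
lemma half_le_norm_packet {φ : 𝓢(ℝ, ℝ)} (hφ : φ 0 = 1) {B : ℝ}
    (hB : ∀ τ y τ' y' : ℝ, ‖packet (profile φ) τ y - packet (profile φ) τ' y'‖ ≤
      B * (|τ - τ'| + |y - y'|)) {τ y : ℝ} (h : B * (|τ| + |y|) ≤ 1 / 2) :
    1 / 2 ≤ ‖packet (profile φ) τ y‖ := by
  have h1 := hB 0 0 τ y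
  rw [packet_profile_zero, hφ] at h1
  simp only [zero_sub, abs_neg, Complex.ofReal_one] at h1
  have h2 := norm_sub_norm_le (1 : ℂ) (packet (profile φ) τ y)
  rw [norm_one] at h2
  linarith

/-- In each of the other variables, the evolved datum at an admissible point is a Gauss sum with
slowly varying weights. -/
lemma div_sqrt_le_norm_sum_packet {φ : 𝓢(ℝ, ℝ)} (hφ : φ 0 = 1) {B : ℝ} (hB0 : 0 ≤ B)
    (hB : ∀ τ y τ' y' : ℝ, ‖packet (profile φ) τ y - packet (profile φ) τ' y'‖ ≤
      B * (|τ - τ'| + |y - y'|)) {c : ℝ} (hc0 : 0 ≤ c)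
    (hc : c * (4 * (∫ η, ‖profile φ η‖) + 11 * B) ≤ 1 / 16) {R D : ℝ} (hD : 1 ≤ D) (hR : 4 * D ≤ R)
    {q : ℕ} [NeZero q] {p₀ p : ℤ} (hp₀ : IsCoprime p₀ q)
    (h0 : (q : ℤ) ≡ 0 [ZMOD 4] → Even p) (h2 : (q : ℤ) ≡ 2 [ZMOD 4] → Odd p)
    (hE : 4 * Real.sqrt 2 * q * (1 + Real.log q) ≤ (freqs R D).card) {t x : ℝ}
    (ht : t = 2 * p₀ / (q * D ^ 2)) (ht0 : 0 ≤ t) (htR : t * R ≤ 3 / 2 * c) (hx : |x| ≤ c)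
    (hxp : |x - p / (D * q)| ≤ c * R⁻¹ / 2) :
    (freqs R D).card / (4 * Real.sqrt q) ≤ ‖∑ l ∈ freqs R D,
      e (-Real.pi * t * (D * l) ^ 2 + 2 * Real.pi * x * (D * l)) *
        packet (profile φ) t (x - t * (D * l))‖ := by
  have hq : (0 : ℝ) < q := by exact_mod_cast Nat.pos_of_ne_zero (NeZero.ne q)
  have hD0 : 0 < D := by linarith
  have hR0 : 0 < R := by linarith
  set J := ∫ η, ‖profile φ η‖ with hJ
  have hJ0 : 0 ≤ J := integral_nonneg fun _ => norm_nonneg _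
  obtain ⟨hM1, hM2, -⟩ := card_freqs_bounds hD hR
  have hMpos : 0 < (freqs R D).card := by
    have : 0 < R / (4 * D) := by positivity
    exact_mod_cast this.trans_le hM1
  rw [sum_freqs_eq_sum_range hMpos]
  have hceil : ((⌊R / (2 * D)⌋ + 1 : ℤ) : ℝ) + (freqs R D).card ≤ R / D + 1 := by
    have h3 : (freqs R D).card = (⌈R / D⌉ - ⌊R / (2 * D)⌋ - 1).toNat := by
      unfold freqs; rw [Int.card_Ioo]
    have h4 : (⌊R / (2 * D)⌋ + 1) + ((freqs R D).card : ℤ) = ⌈R / D⌉ := by omega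
    have h5 : ((⌊R / (2 * D)⌋ + 1 : ℤ) : ℝ) + (freqs R D).card = ⌈R / D⌉ := by
      rw [← h4]; push_cast; ring
    rw [h5]
    exact (Int.ceil_lt_add_one _).le
  have hA0 : (0 : ℝ) ≤ ((⌊R / (2 * D)⌋ + 1 : ℤ) : ℝ) := by
    have : (0 : ℤ) ≤ ⌊R / (2 * D)⌋ := Int.floor_nonneg.2 (by positivity)
    exact_mod_cast (by omega : (0 : ℤ) ≤ ⌊R / (2 * D)⌋ + 1)
  set A : ℤ := ⌊R / (2 * D)⌋ + 1 with hA
  set L := (freqs R D).card with hL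
  set δ := x - p / (D * q) with hδ
  -- The weight collects what remains of the phase after the rational point is taken out. It is also
  -- used at the index `L`, one step beyond the last frequency, where `D * l ≤ R + D`.
  set w : ℕ → ℂ := fun i => e (2 * Real.pi * δ * D * ((A : ℝ) + i)) *
    packet (profile φ) t (x - t * (D * ((A : ℝ) + i))) with hw
  have hterm : ∀ i : ℕ, e (-Real.pi * t * (D * ((A + i : ℤ) : ℝ)) ^ 2 +
      2 * Real.pi * x * (D * ((A + i : ℤ) : ℝ))) *
      packet (profile φ) t (x - t * (D * ((A + i : ℤ) : ℝ))) =
      e (2 * Real.pi * (((-p₀ : ℤ) : ℝ) * ((A : ℝ) + i) ^ 2 + p * ((A : ℝ) + i)) / q) * w i := by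
    intro i
    simp only [hw]
    rw [← mul_assoc (e _) (e _) (packet _ _ _), ← e_add]
    push_cast
    congr 2
    have hx' : x = δ + p / (D * q) := by rw [hδ]; ring
    rw [hx', ht]
    field_simp
    ring
  simp_rw [hterm]
  have htle : t ≤ 3 / 2 * c := le_trans (le_mul_of_one_le_right ht0 (by linarith)) htR
  have hBc : 11 * (c * B) ≤ 1 / 16 := by
    have : 0 ≤ c * J := by positivity
    linarith
  refine div_sqrt_le_norm_weighted_gauss (a := -p₀) (m := p) hp₀.neg_left h0 h2 A L w
    (v := D / R * (c * (Real.pi * J + 3 / 2 * B))) ?_ ?_ ?_ hE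
  · rw [hw]
    simp only
    rw [norm_mul, norm_e, one_mul]
    refine half_le_norm_packet hφ hB ?_
    have h4 : D * ((A : ℝ) + L) ≤ 2 * R := by
      calc D * ((A : ℝ) + L) ≤ D * (R / D + 1) := by gcongr
        _ = R + D := by field_simp
        _ ≤ 2 * R := by linarith
    have h5 : |x - t * (D * ((A : ℝ) + L))| ≤ c + 3 * c := by
      refine (abs_sub _ _).trans (add_le_add hx ?_)
      rw [abs_of_nonneg (by positivity)]
      calc t * (D * ((A : ℝ) + L)) ≤ t * (2 * R) := by gcongr
        _ ≤ _ := by linarith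
    rw [abs_of_nonneg ht0]
    calc B * (t + |x - t * (D * ((A : ℝ) + L))|) ≤ B * (3 / 2 * c + (c + 3 * c)) := by gcongr
      _ ≤ 1 / 2 := by linarith
  · intro i _
    rw [hw]
    simp only
    have h4 : ∀ u v u' v' : ℂ, u' * v' - u * v = (u' - u) * v' + u * (v' - v) := by
      intros; ring
    rw [h4]
    refine (norm_add_le _ _).trans ?_
    rw [norm_mul, norm_mul, norm_e, one_mul]
    have h5 : ‖e (2 * Real.pi * δ * D * ((A : ℝ) + (i + 1 : ℕ))) -
        e (2 * Real.pi * δ * D * ((A : ℝ) + i))‖ ≤ 2 * Real.pi * (c * R⁻¹ / 2) * D := by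
      refine (norm_e_sub_e_le _ _).trans ?_
      have : 2 * Real.pi * δ * D * ((A : ℝ) + (i + 1 : ℕ)) - 2 * Real.pi * δ * D * ((A : ℝ) + i) =
          2 * Real.pi * δ * D := by push_cast; ring
      rw [this, abs_mul, abs_mul, abs_of_pos hD0, abs_of_pos (by positivity : 0 < 2 * Real.pi)]
      gcongr
    have h6 := hB t (x - t * (D * ((A : ℝ) + (i + 1 : ℕ)))) t (x - t * (D * ((A : ℝ) + i)))
    have h7 : x - t * (D * ((A : ℝ) + (i + 1 : ℕ))) - (x - t * (D * ((A : ℝ) + i))) = -(t * D) := by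
      push_cast; ring
    rw [h7, sub_self, abs_zero, zero_add, abs_neg, abs_of_nonneg (by positivity : 0 ≤ t * D)] at h6
    have h8 : t * D ≤ 3 / 2 * c * (D / R) := by
      rw [mul_div_assoc', le_div_iff₀ hR0]
      calc t * D * R = (t * R) * D := by ring
        _ ≤ _ := by gcongr
    calc _ ≤ 2 * Real.pi * (c * R⁻¹ / 2) * D * J + B * (3 / 2 * c * (D / R)) :=
          add_le_add (mul_le_mul h5 (norm_packet_le _ _ _) (norm_nonneg _) (by positivity))
            (h6.trans (by gcongr))
      _ = _ := by field_simp
  · have h4 : (L : ℝ) * (D / R) ≤ 3 / 4 := by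
      have h5 : (R / (2 * D) + 1) * (D / R) = 1 / 2 + D / R := by field_simp
      have h6 : D / R ≤ 1 / 4 := by rw [div_le_iff₀ hR0]; linarith
      calc (L : ℝ) * (D / R) ≤ (R / (2 * D) + 1) * (D / R) := by gcongr
        _ ≤ _ := by rw [h5]; linarith
    have hpi : Real.pi * J ≤ 4 * J := by
      gcongr
      exact Real.pi_le_four
    calc (L : ℝ) * (D / R * (c * (Real.pi * J + 3 / 2 * B)))
        = (L : ℝ) * (D / R) * (c * (Real.pi * J + 3 / 2 * B)) := by ring
      _ ≤ 1 * (c * (4 * J + 11 * B)) := by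
          gcongr
          · linarith
          · linarith
      _ ≤ 1 / 16 := by linarith

/-! ### The other scales -/

/-- At the time `t ≈ x₁ / R_k`, the pieces of scale `j ≠ k` are far from `x`. -/
lemma mul_one_add_le_abs_sub {c₁ x₀ t : ℝ} (hc : 0 < c₁) (hc1 : c₁ ≤ 1) (hx : c₁ / 10 ≤ x₀)
    (hx' : x₀ ≤ c₁) {k : ℕ} (ht : |x₀ - t * R k| ≤ c₁ / 100) {j : ℕ} (hj : j ≠ k) :
    c₁ / 50 * (1 + t * R j) ≤ |x₀ - t * R j| := by
  rw [abs_le] at ht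
  have hR : ∀ i : ℕ, R (i + 1) = 2 * R i := fun i => by unfold R; ring
  have hmono : ∀ i m : ℕ, i ≤ m → R i ≤ R m := fun i m h => by
    unfold R; gcongr; norm_num
  have hk := R_pos k
  have hu : 0 < t * R k := by linarith
  have ht0 : 0 < t := by
    by_contra! h
    nlinarith
  have hv : 0 < t * R j := mul_pos ht0 (R_pos j)
  rcases lt_or_gt_of_ne hj with h | h
  · have h1 : 2 * R j ≤ R k := by rw [← hR]; exact hmono _ _ h
    have h2 : 2 * (t * R j) ≤ t * R k := by nlinarith
    refine le_trans ?_ (le_abs_self _)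
    nlinarith
  · have h1 : 2 * R k ≤ R j := by rw [← hR]; exact hmono _ _ h
    have h2 : 2 * (t * R k) ≤ t * R j := by nlinarith
    rw [abs_sub_comm]
    refine le_trans ?_ (le_abs_self _)
    nlinarith

/-- For `k` large and `q ≤ Q_k`, the completion error `√q log q` is negligible with respect to the
main term `M / √q` of the Gauss sum, `M` being the number of frequencies. -/
lemma eventually_log_mul_le_card {n : ℕ} {a b : ℝ} (hn : 2 ≤ n) (hab : AdmissibleParams a b) :
    ∀ᶠ k in atTop, ∀ q : ℝ, 1 ≤ q → q ≤ Q n a b k →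
      4 * Real.sqrt 2 * q * (1 + Real.log q) ≤ (freqs (R k) (D n a b k)).card := by
  have hκ := gain_pos hn hab
  have h0 := (summable_mul_R_rpow_neg hκ).tendsto_atTop_zero
  filter_upwards [eventually_goodScale hn hab,
    h0.eventually_le_const (by norm_num : (0 : ℝ) < 1 / 48),
    (tendsto_R_rpow hκ).eventually_ge_atTop 48] with k hk h1 h2 q hq hqQ
  have hR := R_pos k
  have hD := D_pos (n := n) (a := a) (b := b) k
  have hD1 : 1 ≤ D n a b k := by linarith [hk.1]
  have hG : 0 < R k ^ gain n a b := Real.rpow_pos_of_pos hR _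
  have h5 := (card_freqs_bounds hD1 hk.2).1
  have h6 := R_rpow_gain_mul (n := n) (a := a) (b := b) k
  rw [Real.rpow_neg hR.le, ← div_eq_mul_inv, div_le_iff₀ hG] at h1
  have hQ1 := one_le_Q hn hab k
  have hQR : Q n a b k ≤ R k := by
    rw [← h6]
    have : 1 * (1 * Q n a b k) ≤ R k ^ gain n a b * (D n a b k * Q n a b k) := by
      gcongr
      linarith
    linarith
  have hlog : Real.log q ≤ k := by
    have h7 : Real.log q ≤ Real.log (R k) := Real.log_le_log (by linarith) (hqQ.trans hQR)
    refine h7.trans ?_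
    unfold R
    rw [Real.log_pow]
    have := Real.log_two_lt_d9
    refine mul_le_of_le_one_right (by positivity) (by linarith)
  have hs2 : Real.sqrt 2 ≤ 3 / 2 := by
    rw [Real.sqrt_le_left (by norm_num)]; norm_num
  refine le_trans ?_ h5
  have h8 : R k / (4 * D n a b k) = R k ^ gain n a b * Q n a b k / 4 := by
    rw [div_eq_div_iff (by positivity) (by norm_num)]
    nth_rewrite 1 [← h6]
    ring
  rw [h8]
  have hl0 : 0 ≤ Real.log q := Real.log_nonneg hq
  calc 4 * Real.sqrt 2 * q * (1 + Real.log q) ≤ 4 * (3 / 2) * Q n a b k * (1 + k) := by gcongr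
    _ = Q n a b k * (6 * (1 + k)) := by ring
    _ ≤ Q n a b k * (R k ^ gain n a b / 4) := by
        gcongr
        linarith
    _ = _ := by ring

section

variable {n : ℕ} [NeZero n] {φ : 𝓢(ℝ, ℝ)} {a b : ℝ}

/-- The pieces at distance `≳ 1 + t R_j` contribute a convergent sum, by rapid decay. -/
lemma exists_coeff_mul_norm_evolved_le (hn : 2 ≤ n) (hab : AdmissibleParams a b)
    (hψ : ∀ η, 1 ≤ |η| → profile φ η = 0) (hφ : φ 0 = 1) {σ : ℝ} (hσ : 0 < σ) :
    ∃ C : ℝ, 0 ≤ C ∧ ∀ j, GoodScale n a b j → ∀ t : ℝ, 0 ≤ t → ∀ x : EuclideanSpace ℝ (Fin n),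
      σ * (1 + t * R j) ≤ |x 0 - t * R j| →
      ‖(coeff n φ a b j : ℂ) * evolved n φ a b j t x‖ ≤ C * (j * R j ^ (-1 : ℝ)) := by
  obtain ⟨B, hB0, hB⟩ := exists_coeff_le (φ := φ) hn hab hψ hφ
  -- Each of the `2 n` integrations by parts gains `R_j ^ (-1/2)`; the trivial bound for the other
  -- variables loses `R_j ^ (n - 1)`, which leaves `R_j ^ (-1)`.
  obtain ⟨A, hA0, hA⟩ := exists_pow_mul_norm_packet_le (2 * n) (profile φ)
  set J := ∫ η, ‖profile φ η‖ with hJ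
  have hJ0 : 0 ≤ J := integral_nonneg fun _ => norm_nonneg _
  refine ⟨B * (A / σ ^ (2 * n)) * J ^ (n - 1), by positivity, fun j hj t ht x hx => ?_⟩
  have hR := R_pos j
  have hs := Real.sqrt_pos.2 hR
  have hM := (card_freqs_bounds (by linarith [hj.1] : 1 ≤ D n a b j) hj.2).2.2
  set P := ‖packet (profile φ) (t * R j) (Real.sqrt (R j) * (x 0 - t * R j))‖ with hP
  have hP1 : P ≤ A / σ ^ (2 * n) * (R j ^ n)⁻¹ := by
    have h1 := hA (t * R j) (Real.sqrt (R j) * (x 0 - t * R j))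
    rw [abs_mul, abs_of_pos hs, abs_of_nonneg (by positivity : 0 ≤ t * R j), mul_pow, pow_mul,
      Real.sq_sqrt hR.le] at h1
    have h2 : (σ * (1 + t * R j)) ^ (2 * n) ≤ |x 0 - t * R j| ^ (2 * n) := by gcongr
    have h3 : R j ^ n * (σ * (1 + t * R j)) ^ (2 * n) * P ≤ A * (1 + t * R j) ^ (2 * n) :=
      le_trans (by gcongr) h1
    have h4 : 0 < (1 + t * R j) ^ (2 * n) := by positivity
    rw [← div_eq_mul_inv, div_div, le_div_iff₀ (by positivity)]
    rw [mul_pow] at h3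
    refine le_of_mul_le_mul_right ?_ h4
    linarith
  have hev : ‖evolved n φ a b j t x‖ ≤ P * (R j * J) ^ (n - 1) := by
    unfold evolved
    rw [norm_mul, norm_mul, norm_e, one_mul, norm_prod]
    gcongr
    have hcard : (Finset.univ.erase (0 : Fin n)).card = n - 1 := by
      rw [Finset.card_erase_of_mem (Finset.mem_univ _), Finset.card_univ, Fintype.card_fin]
    rw [← hcard, ← Finset.prod_const]
    refine Finset.prod_le_prod (fun _ _ => norm_nonneg _) fun i _ => ?_
    · refine (norm_sum_le _ _).trans ((Finset.sum_le_card_nsmul _ _ J fun l _ => ?_).trans ?_)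
      · rw [norm_mul, norm_e, one_mul]
        exact norm_packet_le _ _ _
      · rw [nsmul_eq_mul]
        gcongr
  rw [norm_mul, Complex.norm_real, Real.norm_of_nonneg (coeff_nonneg _)]
  have hRn : (R j ^ n)⁻¹ * R j ^ (n - 1) = R j ^ (-1 : ℝ) := by
    rw [Real.rpow_neg_one]
    obtain ⟨r, hr⟩ := Nat.exists_eq_succ_of_ne_zero (NeZero.ne n)
    rw [hr, Nat.succ_sub_one, pow_succ]
    field_simp
  calc coeff n φ a b j * ‖evolved n φ a b j t x‖
      ≤ (B * j) * ((A / σ ^ (2 * n) * (R j ^ n)⁻¹) * (R j * J) ^ (n - 1)) :=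
        mul_le_mul (hB j hj) (hev.trans (by gcongr)) (norm_nonneg _) (by positivity)
    _ = B * (A / σ ^ (2 * n)) * J ^ (n - 1) * (j * ((R j ^ n)⁻¹ * R j ^ (n - 1))) := by
        rw [mul_pow]; ring
    _ = _ := by rw [hRn]

/-- On a slab of scale `k` the evolved `k`-th term is of size at least `≈ k`. -/
lemma le_norm_coeff_mul_evolved (hφ : φ 0 = 1) {B : ℝ} (hB0 : 0 ≤ B)
    (hB : ∀ τ y τ' y' : ℝ, ‖packet (profile φ) τ y - packet (profile φ) τ' y'‖ ≤
      B * (|τ - τ'| + |y - y'|)) {c : ℝ} (hc0 : 0 ≤ c)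
    (hc : c * (4 * (∫ η, ‖profile φ η‖) + 11 * B) ≤ 1 / 16) {k : ℕ} (hk : GoodScale n a b k)
    {q : ℕ} [NeZero q] {p : Fin n → ℤ} (hadm : AdmissibleFraction p q)
    (hE : 4 * Real.sqrt 2 * q * (1 + Real.log q) ≤ (freqs (R k) (D n a b k)).card)
    {x : EuclideanSpace ℝ (Fin n)} (hx : x ∈ slab c a b k p q) (hxc : ∀ j, |x j| ≤ c) {t : ℝ}
    (ht : t = 2 * p 0 / (q * D n a b k ^ 2)) (ht0 : 0 ≤ t) :
    coeff n φ a b k * ((freqs (R k) (D n a b k)).card / (4 * Real.sqrt q)) ^ (n - 1) ≤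
      2 * ‖(coeff n φ a b k : ℂ) * evolved n φ a b k t x‖ := by
  have hR := R_pos k
  have hR1 := one_le_R k
  have hs := Real.sqrt_pos.2 hR
  have hD := D_pos (n := n) (a := a) (b := b) k
  have hJ0 : 0 ≤ ∫ η, ‖profile φ η‖ := integral_nonneg fun _ => norm_nonneg _
  have hBc : 11 * (c * B) ≤ 1 / 16 := by
    have : 0 ≤ c * ∫ η, ‖profile φ η‖ := by positivity
    linarith
  obtain ⟨hx0, hxj⟩ := hx
  have htR : 2 * p 0 * R k / ((q : ℤ) * D n a b k ^ 2) = t * R k := by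
    rw [ht]; push_cast; ring
  rw [htR, Real.rpow_neg hR.le, ← Real.sqrt_eq_rpow] at hx0
  have hs1 : 1 ≤ Real.sqrt (R k) := by simpa using Real.sqrt_le_sqrt hR1
  have hinv : (Real.sqrt (R k))⁻¹ ≤ 1 := inv_le_one_of_one_le₀ hs1
  have hy : |Real.sqrt (R k) * (x 0 - t * R k)| ≤ c / 2 := by
    rw [abs_mul, abs_of_pos hs]
    calc Real.sqrt (R k) * |x 0 - t * R k| ≤ Real.sqrt (R k) * (c * (Real.sqrt (R k))⁻¹ / 2) := by
          gcongr
      _ = c / 2 := by field_simp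
  have hτ : t * R k ≤ 3 / 2 * c := by
    have h1 : c * (Real.sqrt (R k))⁻¹ ≤ c := mul_le_of_le_one_right hc0 hinv
    have h2 := (abs_le.1 hx0).1
    have h3 := (abs_le.1 (hxc 0)).2
    linarith
  have hfirst : 1 / 2 ≤ ‖packet (profile φ) (t * R k) (Real.sqrt (R k) * (x 0 - t * R k))‖ := by
    refine half_le_norm_packet hφ hB ?_
    rw [abs_of_nonneg (by positivity : 0 ≤ t * R k)]
    calc _ ≤ B * (3 / 2 * c + c / 2) := by gcongr
      _ ≤ 1 / 2 := by linarith
  have hcard : (Finset.univ.erase (0 : Fin n)).card = n - 1 := by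
    rw [Finset.card_erase_of_mem (Finset.mem_univ _), Finset.card_univ, Fintype.card_fin]
  have hprod : ((freqs (R k) (D n a b k)).card / (4 * Real.sqrt q)) ^ (n - 1) ≤
      ∏ j ∈ Finset.univ.erase (0 : Fin n), ‖∑ l ∈ freqs (R k) (D n a b k),
        e (-Real.pi * t * (D n a b k * l) ^ 2 + 2 * Real.pi * x j * (D n a b k * l)) *
        packet (profile φ) t (x j - t * (D n a b k * l))‖ := by
    rw [← hcard, ← Finset.prod_const]
    refine Finset.prod_le_prod (fun _ _ => by positivity) fun j hj => ?_
    have hj0 := Finset.ne_of_mem_erase hj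
    refine div_sqrt_le_norm_sum_packet hφ hB0 hB hc0 hc (by linarith [hk.1]) hk.2 hadm.1
      (p := p j) (fun h => hadm.2.1 h j hj0) (fun h => hadm.2.2 h j hj0) hE ht ht0 hτ (hxc j) ?_
    simpa using hxj j hj0
  unfold evolved
  rw [norm_mul, norm_mul, norm_mul, norm_e, one_mul, norm_prod, Complex.norm_real,
    Real.norm_of_nonneg (coeff_nonneg _)]
  have h1 := mul_le_mul hfirst hprod (by positivity) (norm_nonneg _)
  have h2 := mul_le_mul_of_nonneg_left h1 (coeff_nonneg (n := n) (φ := φ) (a := a) (b := b) k)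
  linarith

/-- Lower bound for the solution at the time attached to a slab through `x`. -/
lemma exists_le_norm_flow (hn : 2 ≤ n) (hab : AdmissibleParams a b)
    (hψ : ∀ η, 1 ≤ |η| → profile φ η = 0) (hφ : φ 0 = 1) {B : ℝ} (hB0 : 0 ≤ B)
    (hB : ∀ τ y τ' y' : ℝ, ‖packet (profile φ) τ y - packet (profile φ) τ' y'‖ ≤
      B * (|τ - τ'| + |y - y'|)) {c c₁ : ℝ} (hc0 : 0 < c)
    (hc : c * (4 * (∫ η, ‖profile φ η‖) + 11 * B) ≤ 1 / 16) (hc₁ : 0 < c₁) (hc₁c : c₁ ≤ c)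
    (hc₁1 : c₁ ≤ 1) {k₀ : ℕ} (hk₀ : ∀ k, k₀ ≤ k → GoodScale n a b k) :
    ∃ κ C : ℝ, 0 < κ ∧ ∀ᶠ k in atTop, ∀ x ∈ divSetAt n c a b k ∩ box n (c₁ / 10) c₁,
      ∃ t : ℝ, 0 < t ∧ t ≤ 2 * c₁ * R k ^ (-1 : ℝ) ∧ κ * k - C ≤ ‖flow (g n φ a b k₀) t x‖ := by
  obtain ⟨κ, hκ0, hκ⟩ := exists_mul_le_coeff_mul (a := a) (b := b) hn hψ hφ
  obtain ⟨C, hC0, hC⟩ := exists_coeff_mul_norm_evolved_le hn hab hψ hφ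
    (by positivity : 0 < c₁ / 50)
  set bound : ℕ → ℝ := fun m => C * (((m + k₀ : ℕ) : ℝ) * R (m + k₀) ^ (-1 : ℝ)) with hbound
  have hbs : Summable bound := Summable.mul_left _ ((summable_nat_add_iff k₀).2
      (summable_mul_R_rpow_neg one_pos))
  refine ⟨κ / 2, ∑' m, bound m, by positivity, ?_⟩
  filter_upwards [eventually_ge_atTop k₀, eventually_log_mul_le_card hn hab,
    (tendsto_R_rpow (by norm_num : (0 : ℝ) < 1 / 2)).eventually_ge_atTop (c / (2 * (c₁ / 100)))]
    with k hkk₀ hE hsmall x hx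
  obtain ⟨⟨p, q, hq1, hqQ, hadm, hslab⟩, hbox⟩ := hx
  lift q to ℕ using by omega
  have hq1' : 1 ≤ q := by exact_mod_cast hq1
  have : NeZero q := ⟨by omega⟩
  have hk := hk₀ k hkk₀
  have hR := R_pos k
  rw [Int.cast_natCast] at hqQ
  set t : ℝ := 2 * p 0 / (q * D n a b k ^ 2) with ht
  have htR : 2 * p 0 * R k / ((q : ℤ) * D n a b k ^ 2) = t * R k := by
    rw [ht]; push_cast; ring
  have hclose : |x 0 - t * R k| ≤ c₁ / 100 := by
    have h1 := hslab.1
    rw [htR, Real.rpow_neg hR.le] at h1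
    refine h1.trans ?_
    have hpos : 0 < R k ^ (1 / 2 : ℝ) := Real.rpow_pos_of_pos hR _
    rw [div_le_iff₀ (by positivity)] at hsmall
    rw [← div_eq_mul_inv, div_div, div_le_iff₀ (by positivity)]
    linarith
  have habs := abs_le.1 hclose
  have hbox0 := hbox.1
  have hu : 0 < t * R k := by linarith [hbox0.1]
  have ht0 : 0 < t := pos_of_mul_pos_left hu hR.le
  have hxc : ∀ j, |x j| ≤ c := by
    intro j
    by_cases hj : j = 0
    · rw [hj, abs_of_nonneg (by linarith [hbox0.1])]
      linarith [hbox0.2]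
    · have := hbox.2 j hj
      rw [abs_of_nonneg this.1]
      linarith [this.2]
  refine ⟨t, ht0, ?_, ?_⟩
  · rw [Real.rpow_neg_one, ← div_eq_mul_inv, le_div_iff₀ hR]
    linarith [hbox0.2]
  · have hmain := le_norm_coeff_mul_evolved (a := a) (b := b) hφ hB0 hB hc0.le hc hk hadm
      (hE q (by exact_mod_cast hq1') hqQ) hslab hxc ht ht0.le
    have hκ' := hκ k hk q (by positivity) hqQ
    obtain ⟨m₀, rfl⟩ := Nat.exists_eq_add_of_le hkk₀
    have hsum := (hasSum_flow_g hn hab hψ hφ hk₀ ht0 x).2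
    set T : ℕ → ℂ := fun m => (coeff n φ a b (k₀ + m) : ℂ) * evolved n φ a b (k₀ + m) t x with hT
    have hsplit : flow (g n φ a b k₀) t x = T m₀ + ∑' m, if m = m₀ then 0 else T m := by
      rw [← hsum.tsum_eq]
      exact hsum.summable.tsum_eq_add_tsum_ite m₀
    have hrest : ‖∑' m, if m = m₀ then 0 else T m‖ ≤ ∑' m, bound m := by
      refine tsum_of_norm_bounded hbs.hasSum fun m => ?_
      split_ifs with hm
      · rw [norm_zero, hbound]
        have := R_pos (m + k₀)
        positivity
      · rw [hbound, hT]
        simp only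
        rw [add_comm m k₀]
        exact hC _ (hk₀ _ (by omega)) t ht0.le x
          (mul_one_add_le_abs_sub hc₁ hc₁1 hbox0.1 hbox0.2 hclose (by omega))
    rw [hsplit]
    have h3 := norm_sub_le (T m₀ + ∑' m, if m = m₀ then 0 else T m)
      (∑' m, if m = m₀ then 0 else T m)
    rw [add_sub_cancel_right] at h3
    linarith

lemma flowLimsup_eq_top (hn : 2 ≤ n) (hab : AdmissibleParams a b)
    (hψ : ∀ η, 1 ≤ |η| → profile φ η = 0) (hφ : φ 0 = 1) {B : ℝ} (hB0 : 0 ≤ B)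
    (hB : ∀ τ y τ' y' : ℝ, ‖packet (profile φ) τ y - packet (profile φ) τ' y'‖ ≤
      B * (|τ - τ'| + |y - y'|)) {c c₁ : ℝ} (hc0 : 0 < c)
    (hc : c * (4 * (∫ η, ‖profile φ η‖) + 11 * B) ≤ 1 / 16) (hc₁ : 0 < c₁) (hc₁c : c₁ ≤ c)
    (hc₁1 : c₁ ≤ 1) {k₀ : ℕ} (hk₀ : ∀ k, k₀ ≤ k → GoodScale n a b k)
    {x : EuclideanSpace ℝ (Fin n)} (hx : x ∈ divSet n c a b ∩ box n (c₁ / 10) c₁) :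
    flowLimsup (g n φ a b k₀) x = ∞ := by
  obtain ⟨κ, C, hκ, hev⟩ := exists_le_norm_flow hn hab hψ hφ hB0 hB hc0 hc hc₁ hc₁c hc₁1 hk₀
  refine ENNReal.eq_top_of_forall_nnreal_le fun r => ?_
  refine le_limsup_of_frequently_le ?_
  intro hnot
  rw [Filter.Eventually, Metric.mem_nhdsWithin_iff] at hnot
  obtain ⟨δ, hδ, hsub⟩ := hnot
  have hlim1 : Tendsto (fun k : ℕ => κ * k - C) atTop atTop :=
    tendsto_atTop_add_const_right _ _ ((tendsto_natCast_atTop_atTop).const_mul_atTop hκ)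
  have hlim2 : Tendsto (fun k : ℕ => 2 * c₁ * R k ^ (-1 : ℝ)) atTop (𝓝 0) := by
    have h1 : Tendsto (fun k : ℕ => R k ^ (-1 : ℝ)) atTop (𝓝 0) := by
      simp_rw [Real.rpow_neg_one]
      exact (tendsto_pow_atTop_atTop_of_one_lt (by norm_num : (1 : ℝ) < 2)).inv_tendsto_atTop
    simpa using h1.const_mul (2 * c₁)
  obtain ⟨N, hN⟩ := eventually_atTop.1 (hev.and ((hlim1.eventually_ge_atTop (r : ℝ)).and
    (hlim2.eventually_lt_const hδ)))
  obtain ⟨k, hkN, hxk⟩ : ∃ k, N ≤ k ∧ x ∈ divSetAt n c a b k := by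
    have := Set.mem_iInter.1 hx.1 N
    simpa using this
  obtain ⟨h1, h2, h3⟩ := hN k hkN
  obtain ⟨t, ht0, htle, hflow⟩ := h1 x ⟨hxk, hx.2⟩
  have hmem : t ∈ Metric.ball (0 : ℝ) δ ∩ {t : ℝ | 0 < t ∧ FlowDefinedAt (g n φ a b k₀) t x} := by
    refine ⟨?_, ht0, (hasSum_flow_g hn hab hψ hφ hk₀ ht0 x).1⟩
    rw [Metric.mem_ball, dist_zero_right, Real.norm_of_nonneg ht0.le]
    linarith
  refine hsub hmem ?_
  have h4 : (r : ℝ) ≤ ‖flow (g n φ a b k₀) t x‖ := by linarith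
  change (r : ℝ≥0∞) ≤ ‖flow (g n φ a b k₀) t x‖ₑ
  rw [enorm_eq_nnnorm]
  exact_mod_cast h4

end

end CarlesonFractal

end

theorem mainTheorem3 (n : ℕ) [NeZero n] (hn : 2 ≤ n) (φ : 𝓢(ℝ, ℝ))
    (hφ_nonneg : ∀ y, 0 ≤ φ y) (hφ_zero : φ 0 = 1)
    (hφ_supp : tsupport (𝓕 (fun y : ℝ => ((φ y : ℝ) : ℂ))) ⊆ Metric.ball (0 : ℝ) 1) :
    ∃ ε : ℝ, 0 < ε ∧ ∀ a b : ℝ, CarlesonFractal.AdmissibleParams a b →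
      ∃ K : ℕ, ∀ k₀ : ℕ, K ≤ k₀ →
        (∀ k : ℕ, k₀ ≤ k → CarlesonFractal.fDk n φ a b k ≠ 0) ∧
        Summable (fun m : ℕ => CarlesonFractal.gTerm n φ a b (k₀ + m)) ∧
        (∀ s' : ℝ, s' < CarlesonFractal.sExp n a b →
          TemperedDistribution.MemSobolev s' 2
            (CarlesonFractal.g n φ a b k₀ : 𝓢'(EuclideanSpace ℝ (Fin n), ℂ))) ∧
        ∀ c c₁ : ℝ, 0 < c → c ≤ ε → 0 < c₁ → c₁ ≤ ε * c →
          ∃ Ω : Set (EuclideanSpace ℝ (Fin n)),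
            (∀ γ : ℝ, (n : ℝ) - 2 * CarlesonFractal.sExp n a b < γ → μH[γ] Ω = 0) ∧
            ∀ x ∈ (CarlesonFractal.divSet n c a b ∩ CarlesonFractal.box n (c₁ / 10) c₁) \ Ω,
              CarlesonFractal.flowLimsup (CarlesonFractal.g n φ a b k₀) x = ∞ := by
  have hψ : ∀ η, 1 ≤ |η| → CarlesonFractal.profile φ η = 0 := fun η hη =>
    CarlesonFractal.profile_eq_zero hφ_supp hη
  obtain ⟨B, hB0, hB⟩ := CarlesonFractal.exists_norm_packet_sub_le (CarlesonFractal.profile φ)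
  set J := ∫ η, ‖CarlesonFractal.profile φ η‖ with hJ
  have hJ0 : 0 ≤ J := integral_nonneg fun _ => norm_nonneg _
  have hden : 0 < 16 * (4 * J + 11 * B + 1) := by positivity
  -- This `ε` makes all phases in the packets and the total variation of the Gauss sum weights
  -- small; it depends only on `φ`, through the `L¹` norm `J` and the Lipschitz constant `B`.
  refine ⟨1 / (16 * (4 * J + 11 * B + 1)), by positivity, fun a b hab => ?_⟩
  obtain ⟨K, hK⟩ := eventually_atTop.1 (CarlesonFractal.eventually_goodScale hn hab)
  refine ⟨K, fun k₀ hk₀ => ?_⟩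
  have hgood : ∀ k, k₀ ≤ k → CarlesonFractal.GoodScale n a b k := fun k hk => hK k (hk₀.trans hk)
  refine ⟨fun k hk => CarlesonFractal.fDk_ne_zero hψ hφ_zero (hgood k hk),
    (CarlesonFractal.summable_norm_gTerm hn hab hψ hφ_zero hgood).of_norm,
    fun s' hs' => CarlesonFractal.memSobolev_g hn hab hψ hφ_zero hgood hs',
    -- The pointwise limit exists everywhere for `t > 0`, so there is no exceptional set.
    fun c c₁ hc hcε hc₁ hc₁ε => ⟨∅, fun γ _ => measure_empty, fun x hx => ?_⟩⟩
  have hε1 : 1 / (16 * (4 * J + 11 * B + 1)) ≤ 1 := by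
    rw [div_le_one hden]; linarith
  have hc₁c : c₁ ≤ c := hc₁ε.trans (mul_le_of_le_one_left hc.le hε1)
  refine CarlesonFractal.flowLimsup_eq_top hn hab hψ hφ_zero hB0 hB hc ?_ hc₁ hc₁c
    (hc₁c.trans (hcε.trans hε1)) hgood hx.1
  rw [le_div_iff₀ hden] at hcε
  linarith
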